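/- **Setting.** A Markov game has $m\ge 1$ agents, episodes of $H\ge 1$ steps, finite layers $\mathcal S_1,\dots,\mathcal S_{H+1}$ of states, an initial state $s_1\in\mathcal S_1$, finite nonempty action sets $\mathcal A^i$ with $\mathcal A=\prod_i\mathcal A^i$, transition laws $\mathbb P(\cdot\mid s,a)$ from each layer to the next, and losses $\ell^i(s,a)\in[0,1]$. Put $S=\sum_{h\le H}|\mathcal S_h|$. A Markov joint policy is a map $\pi:\mathcal S\to\triangle(\mathcal A)$; $V^i_\pi$ is the expected total remaining loss of agent $i$, and $V^i_{\dagger,\pi^{-i}}(s)=\min_{\pi^i_*}V^i_{\pi^i_*,\pi^{-i}}(s)$ over the Markov policies $\pi^i_*$ of agent $i$. The uniform mixture of Markov joint policies $\pi_1,\dots,\pi_n$ draws an index at the beginning of an episode and follows the policy drawn; it is an $\epsilon$-CCE if no agent $i$ can lower its expected total loss from $s_1$ by more than $\epsilon$ by deviating to a Markov policy of its own. **Subroutines.** $\textsc{CCE-Approx}_h(\bar\pi,\bar V,K)$ is a randomized procedure that returns $\tilde\pi:\mathcal S_h\to\triangle(\mathcal A)$ and $\mathsf{Gap}:\mathcal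 S_h\to\mathbb R_{\ge 0}^m$ with finite expectation, and $\textsc{V-Approx}_h(\bar\pi,\tilde\pi,\bar V,\mathsf{Gap},K)$ is a randomized procedure that returns $\hat V:\mathcal S_h\to\mathbb R^m$; each call uses fresh randomness, and $\bar V:\mathcal S_{h+1}\to\mathbb R^m$. **Algorithm.** Given $T\ge1$, $\delta\in(0,1)$, $R=\lceil\log_2(S/\delta)\rceil$ and potentials $\Psi_{t,h}^i$ that are functions of the data collected so far. Let $\tilde\pi_0$ be uniform and $t_0=0$. In epoch $t=1,\dots,T$ the agents play $\tilde\pi_{t-1}$ for one episode and record the trajectory. If $t_0\neq0$ and $\Psi_{t,h}^i\le\Psi_{t_0,h}^i+1$ for all $h,i$, the update is lazy: $\tilde\pi_t=\tilde\pi_{t-1}$. Otherwise let $\bar\pi_t$ be the uniform mixture of $\tilde\pi_0,\dots,\tilde\pi_{t-1}$, let $\bar V_t=0$ on $\mathcal S_{H+1}$, and for $h=H,\dots,1$: call $\textsc{CCE-Approx}_h(\bar\pi_t,\bar V_t,t)$ independently $R$ times, with results $(\tilde\pi_r,\mathsf{Gap}_r)$; for each $s\in\mathcal S_h$ set $(\tilde\pi_t(s),\mathsf{Gap}_t(s))=(\tilde\pi_{r^*(s)}(s),\mathsf{Gap}_{r^*(s)}(s))$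 with $r^*(s)=\arg\min_{r\le R}\sum_i\mathsf{Gap}^i_r(s)$; set $\bar V_t(\mathcal S_h)=\textsc{V-Approx}_h(\bar\pi_t,\tilde\pi_t,\bar V_t,\mathsf{Gap}_t,t)$. Then set $t_0=t$. The output is the uniform mixture of $\tilde\pi_0,\dots,\tilde\pi_T$. **Assumptions.** For all $h\le H$, all inputs $\bar\pi$ (a uniform mixture of finitely many Markov joint policies), $\bar V$, $K\ge1$, and all $i$, $s\in\mathcal S_h$ below: 1. (Per-state no-regret) with probability at least $1-\delta$ the output of $\textsc{CCE-Approx}_h(\bar\pi,\bar V,K)$ satisfies, for all $i$ and $s$, $$\max_{\pi_*^i}\Big(\mathbb E_{a\sim\tilde\pi(s)}-\mathbb E_{a\sim\pi_*^i\times\tilde\pi^{-i}(s)}\Big)\big[(\ell^i+\mathbb P\bar V^i)(s,a)\big]\le\mathsf{Gap}^i(s).$$ 2. (Optimistic V-function) if $(\tilde\pi,\mathsf{Gap})$ is selected as above from $R$ independent executions of $\textsc{CCE-Approx}_h(\bar\pi,\bar V,K)$, then with probability at least $1-\delta$, writing $E^i(s)=\mathbb E_{a\sim\tilde\pi(s)}[(\ell^i+\mathbb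 P\bar V^i)(s,a)]$, the output $\hat V$ of $\textsc{V-Approx}_h(\bar\pi,\tilde\pi,\bar V,\mathsf{Gap},K)$ satisfies, for all $i$ and $s$, $$\hat V^i(s)\in\Big[E^i(s)-2\,\mathsf{Gap}^i(s),\ \max\{E^i(s)-\mathsf{Gap}^i(s),\,0\}\Big].$$ 3. (Pigeon-hole condition and potential) almost surely at most $d_{\rm replay}\log T$ of the epochs $1,\dots,T$ have a non-lazy update, and there is a deterministic $L\ge0$ such that with probability at least $1-\delta$ $$\sum_{t=1}^T\sum_{i=1}^m\mathbb E_{s\sim_h\tilde\pi_t}\big[\mathbb E_{\mathsf{Gap}}[\mathsf{Gap}_t^i(s)]\big]\le m\sqrt{LT\log^2\tfrac T\delta}\quad\text{for all }h\le H.$$ Here $s\sim_h\tilde\pi_t$ is the $h$-th state when $\tilde\pi_t$ is followed, and $\mathbb E_{\mathsf{Gap}}[\mathsf{Gap}^i_t(s)]$ is the expectation of $\mathsf{Gap}^i(s)$ over a single execution of $\textsc{CCE-Approx}_h$ on the (fixed) inputs of the last non-lazy epoch up to $t$. **Conclusion.** There are universal constants $C_1,C_2>0$ such that, with probability at least $1-C_2\,H\,(d_{\rm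 replay}\log T)\,R\,\delta$, $$\sum_{i=1}^m\sum_{t=1}^T\big(V^i_{\tilde\pi_t}(s_1)-V^i_{\dagger,\tilde\pi_t^{-i}}(s_1)\big)\le C_2\,mH\sqrt{LT}\,\log\tfrac T\delta .$$ Suppose moreover that $L\ge1$, that each call with last parameter $K$ uses at most $\Gamma_1K$ samples (for $\textsc{CCE-Approx}$) and at most $\Gamma_2K$ samples (for $\textsc{V-Approx}$), where $\max\{\Gamma_1,\Gamma_2\}\ge1$, that $0<\epsilon\le H$, and that, with $X=m^2H^2L/\epsilon^2$, the number of epochs is $T=\lceil C_1X\log^2(2X/\delta)\rceil$. Then with probability at least $1-C_2\,H\,(d_{\rm replay}\log T)\,R\,\delta$ the output is an $\epsilon$-CCE, even if the deviating agent is told the index that was drawn (that is, $\frac1{T+1}\sum_{t=0}^T(V^i_{\tilde\pi_t}(s_1)-V^i_{\dagger,\tilde\pi_t^{-i}}(s_1))\le\epsilon$ for all $i$), and almost surely the total number of samples is at most $$C_2\,\max\{\Gamma_1,\Gamma_2\}\,m^2H^3L\,\epsilon^{-2}\,d_{\rm replay}\log T\cdot R\,\log^2(2X/\delta).$$ -/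

import Mathlib

open MeasureTheory

universe u v w

namespace AVLPR

noncomputable section

/-! ### Finite probability vectors -/

/-- Probability vectors `△(α)` on a finite type. -/
abbrev ProbVec (α : Type*) [Fintype α] : Type _ := ↥(stdSimplex ℝ α)

/-- The expectation of `f` under `p`. -/
def ProbVec.expect {α : Type*} [Fintype α] (p : ProbVec α) (f : α → ℝ) : ℝ := ∑ a, p.1 a * f a

/-- The uniform distribution. -/
def ProbVec.unif (α : Type*) [Fintype α] [Nonempty α] : ProbVec α :=
  ⟨fun _ => (Fintype.card α : ℝ)⁻¹, fun _ => by positivity, by simp⟩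

/-- `q × p^{-i}`: agent `i` draws its action from `q`, independently of the actions of the other
agents, which are drawn from the marginal of `p` on the coordinates other than `i`. -/
def ProbVec.deviate {m : ℕ} {A : Fin m → Type v} [∀ i, Fintype (A i)]
    (p : ProbVec (∀ i, A i)) (i : Fin m) (q : ProbVec (A i)) : ProbVec (∀ i, A i) :=
  ⟨fun a => q.1 (a i) * ∑ b : A i, p.1 (Function.update a i b),
    fun a => mul_nonneg (q.2.1 _) (Finset.sum_nonneg fun b _ => p.2.1 _), by
      let e : ((∀ i, A i) × A i) ≃ ((∀ i, A i) × A i) :=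
        { toFun := fun x => (Function.update x.1 i x.2, x.1 i)
          invFun := fun x => (Function.update x.1 i x.2, x.1 i)
          left_inv := fun x => by simp
          right_inv := fun x => by simp }
      have h1 : ∑ a : (∀ i, A i), q.1 (a i) * ∑ b : A i, p.1 (Function.update a i b)
          = ∑ x : (∀ i, A i) × A i, q.1 (e x).2 * p.1 (e x).1 := by
        rw [Fintype.sum_prod_type]
        exact Finset.sum_congr rfl fun a _ => Finset.mul_sum _ _ _
      rw [h1, Equiv.sum_comp e (fun x => q.1 x.2 * p.1 x.1), Fintype.sum_prod_type]
      have hq : ∑ b, q.1 b = 1 := q.2.2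
      have hp : ∑ a, p.1 a = 1 := p.2.2
      simp [← Finset.sum_mul, hq, hp]⟩

/-- The smallest minimizer of `f` on `{0, …, n - 1}` (and `0` if `n = 0`). -/
def argminBelow (f : ℕ → ℝ) : ℕ → ℕ
  | 0 => 0
  | n + 1 => if f n < f (argminBelow f n) then n else argminBelow f n

theorem argminBelow_lt (f : ℕ → ℝ) {n : ℕ} (hn : 0 < n) : argminBelow f n < n := by
  induction n with
  | zero => omega
  | succ n ih =>
    rcases Nat.eq_zero_or_pos n with rfl | h
    · simp [argminBelow]
    · have := ih h
      unfold argminBelow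
      split_ifs <;> omega

theorem argminBelow_le (f : ℕ → ℝ) {n r : ℕ} (hr : r < n) : f (argminBelow f n) ≤ f r := by
  induction n with
  | zero => omega
  | succ n ih =>
    unfold argminBelow
    rcases Nat.lt_succ_iff_lt_or_eq.mp hr with h | rfl
    · have := ih h
      split_ifs with hc
      · exact hc.le.trans this
      · exact this
    · split_ifs with hc
      · exact le_rfl
      · exact not_lt.mp hc

/-! ### Markov games -/

/-- A general-sum Markov game with `m` agents and episodes of `H` steps. Layers are indexed from
`0`: the `h`-th step, `h < H`, is taken in a state of `S h`, and `S H` holds the terminal states. -/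
structure MarkovGame (m H : ℕ) (S : ℕ → Type u) (A : Fin m → Type v)
    [∀ h, Fintype (S h)] [∀ i, Fintype (A i)] where
  /-- the initial state -/
  init : S 0
  /-- the transition law -/
  trans : (h : ℕ) → S h → (∀ i, A i) → ProbVec (S (h + 1))
  /-- the (deterministic) loss of each agent -/
  loss : Fin m → (h : ℕ) → S h → (∀ i, A i) → ℝ
  loss_mem : ∀ i h s a, loss i h s a ∈ Set.Icc (0 : ℝ) 1

section Game

variable {m H : ℕ} {S : ℕ → Type u} {A : Fin m → Type v}
  [∀ h, Fintype (S h)] [∀ i, Fintype (A i)]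

/-- Joint policies on one layer; the agents' actions may be correlated. -/
abbrev LayerPolicy {m : ℕ} (S : ℕ → Type u) (A : Fin m → Type v) [∀ i, Fintype (A i)]
    (h : ℕ) : Type _ := S h → ProbVec (∀ i, A i)

/-- Markov joint policies. -/
abbrev Policy {m : ℕ} (S : ℕ → Type u) (A : Fin m → Type v) [∀ i, Fintype (A i)] : Type _ :=
  (h : ℕ) → LayerPolicy S A h

/-- Markov policies of the single agent `i`. -/
abbrev AgentPolicy {m : ℕ} (S : ℕ → Type u) (A : Fin m → Type v) [∀ i, Fintype (A i)]
    (i : Fin m) : Type _ := (h : ℕ) → S h → ProbVec (A i)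

/-- Agent `i` deviates from `π` to its own policy `q`. -/
def deviatePolicy (π : Policy S A) (i : Fin m) (q : AgentPolicy S A i) : Policy S A :=
  fun h s => (π h s).deviate i (q h s)

namespace MarkovGame

/-- `(ℓ^i + P V)(s, a)`, where `V` is a function on the next layer. -/
def bellman (G : MarkovGame m H S A) (i : Fin m) (h : ℕ) (V : S (h + 1) → ℝ) (s : S h)
    (a : ∀ i, A i) : ℝ :=
  G.loss i h s a + (G.trans h s a).expect V

/-- The expected total loss of agent `i` over the `n` steps that start in state `s` of layer `h`. -/
def valueFor (G : MarkovGame m H S A) (π : Policy S A) (i : Fin m) : ℕ → (h : ℕ) → S h → ℝ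
  | 0, _, _ => 0
  | n + 1, h, s => (π h s).expect (G.bellman i h (G.valueFor π i n (h + 1)) s)

/-- The V-function `V^i_π(s)` of a state `s` of layer `h`. -/
def value (G : MarkovGame m H S A) (π : Policy S A) (i : Fin m) (h : ℕ) (s : S h) : ℝ :=
  G.valueFor π i (H - h) h s

/-- The best-response V-function `V^i_{†,π^{-i}}(s)`. -/
def bestResponse (G : MarkovGame m H S A) (π : Policy S A) (i : Fin m) (h : ℕ) (s : S h) : ℝ :=
  ⨅ q : AgentPolicy S A i, G.value (deviatePolicy π i q) i h s

/-- The law of the state in layer `h` when all agents follow `π`. -/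
def visit (G : MarkovGame m H S A) (π : Policy S A) : (h : ℕ) → S h → ℝ
  | 0 => fun s => by classical exact if s = G.init then 1 else 0
  | h + 1 => fun s' => ∑ s, G.visit π h s * (π h s).expect fun a => (G.trans h s a).1 s'

/-- The uniform mixture of the `n` Markov joint policies `π 0, …, π (n - 1)`: at the beginning of
an episode an index is drawn uniformly, and the policy with this index is followed during the whole
episode. It is an `ε`-CCE if no agent gains more than `ε` by deviating to a policy of its own
(which may not depend on the index drawn). For `n = 1` this is the notion of an `ε`-CCE for a
Markov joint policy. -/
def IsCCE (G : MarkovGame m H S A) {n : ℕ} (π : Fin n → Policy S A) (ε : ℝ) : Prop :=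
  ∀ i : Fin m,
    (n : ℝ)⁻¹ * ∑ k, G.value (π k) i 0 G.init
      - ⨅ q : AgentPolicy S A i,
          (n : ℝ)⁻¹ * ∑ k, G.value (deviatePolicy (π k) i q) i 0 G.init ≤ ε

/-- The stronger requirement in which the deviating agent is told the index that was drawn. -/
def IsInformedCCE (G : MarkovGame m H S A) {n : ℕ} (π : Fin n → Policy S A) (ε : ℝ) : Prop :=
  ∀ i : Fin m,
    (n : ℝ)⁻¹ * ∑ k, (G.value (π k) i 0 G.init - G.bestResponse (π k) i 0 G.init) ≤ ε

end MarkovGame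

/-- Trajectories: the state and the joint action of each of the `H` steps. -/
abbrev Traj {m : ℕ} (H : ℕ) (S : ℕ → Type u) (A : Fin m → Type v) : Type _ :=
  (h : Fin H) → S h × (∀ i, A i)

/-- The probability of a trajectory when all agents follow `π`. -/
def MarkovGame.trajProb (G : MarkovGame m H S A) (π : Policy S A) (τ : Traj H S A) : ℝ := by
  classical
  exact (if ∀ h0 : 0 < H, (τ ⟨0, h0⟩).1 = G.init then 1 else 0) *
    ∏ h : Fin H, (π h (τ h).1).1 (τ h).2 *
      (if hh : (h : ℕ) + 1 < H then (G.trans h (τ h).1 (τ h).2).1 (τ ⟨h + 1, hh⟩).1 else 1)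

end Game

/-! ### The framework

All randomness (of the environment, of the agents' actions, and internal to the subroutines) is
supplied by seeds in `Ξ`: each rollout and each call of a subroutine gets a fresh seed of law `ν`,
independent of all others. -/

section Framework

variable {m H : ℕ} {S : ℕ → Type u} {A : Fin m → Type v} {Ξ : Type w}
  [∀ h, Fintype (S h)] [∀ i, Fintype (A i)] [MeasurableSpace Ξ]

/-- A sampler of the trajectories of the game. -/
structure Rollout (G : MarkovGame m H S A) (ν : Measure Ξ) where
  run : Policy S A → Ξ → Traj H S A
  measurable_run : ∀ τ, MeasurableSet {x : Policy S A × Ξ | run x.1 x.2 = τ}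
  law : ∀ π τ, ν.real {ξ | run π ξ = τ} = G.trajProb π τ

/-- A subroutine `CCE-Approx`. In layer `h` its input consists of `π̄`, given as the uniform mixture
of `n` Markov joint policies, of a V-function on the next layer and of a number `K`; it
returns a policy and gap estimates on layer `h`. `cost` is the number of samples it uses. -/
structure CCEApprox {m : ℕ} (S : ℕ → Type u) (A : Fin m → Type v) (Ξ : Type w)
    [∀ i, Fintype (A i)] [MeasurableSpace Ξ] where
  out : (h n : ℕ) → (Fin n → Policy S A) → (S (h + 1) → Fin m → ℝ) → (K : ℕ) → Ξ →
    LayerPolicy S A h × (S h → Fin m → ℝ)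
  cost : (h n : ℕ) → (Fin n → Policy S A) → (S (h + 1) → Fin m → ℝ) → (K : ℕ) → Ξ → ℕ
  measurable_out : ∀ h n K, Measurable
    fun x : (Fin n → Policy S A) × (S (h + 1) → Fin m → ℝ) × Ξ => out h n x.1 x.2.1 K x.2.2

/-- A subroutine `V-Approx`. Its input in layer `h` consists of `π̄`, of a policy on layer `h`, of a
V-function on the next layer, of gap estimates on layer `h` and of a number `K`; it
returns a V-function on layer `h`. -/
structure VApprox {m : ℕ} (S : ℕ → Type u) (A : Fin m → Type v) (Ξ : Type w)
    [∀ i, Fintype (A i)] [MeasurableSpace Ξ] where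
  out : (h n : ℕ) → (Fin n → Policy S A) → LayerPolicy S A h → (S (h + 1) → Fin m → ℝ) →
    (S h → Fin m → ℝ) → (K : ℕ) → Ξ → (S h → Fin m → ℝ)
  cost : (h n : ℕ) → (Fin n → Policy S A) → LayerPolicy S A h → (S (h + 1) → Fin m → ℝ) →
    (S h → Fin m → ℝ) → (K : ℕ) → Ξ → ℕ
  measurable_out : ∀ h n K, Measurable
    fun x : (Fin n → Policy S A) × LayerPolicy S A h × (S (h + 1) → Fin m → ℝ) ×
        (S h → Fin m → ℝ) × Ξ =>
      out h n x.1 x.2.1 x.2.2.1 x.2.2.2.1 K x.2.2.2.2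

/-- The seeds for one layer of one epoch: one for each execution of `CCE-Approx` (only the first
`R` are used), and one for `V-Approx`. -/
abbrev LayerSeed (Ξ : Type w) : Type w := (ℕ → Ξ) × Ξ

/-- The law of the seeds for one layer of one epoch. -/
def layerLaw (ν : Measure Ξ) [IsProbabilityMeasure ν] : Measure (LayerSeed Ξ) :=
  (Measure.infinitePi fun _ : ℕ => ν).prod ν

/-- The potentials `Ψ_{t,h}^i`, calculated from everything observed so far: the trajectories of the
epochs `1, …, t`, and the subroutine calls of the epochs `1, …, t - 1` (through their seeds). -/
structure Potential (m H : ℕ) (S : ℕ → Type u) (A : Fin m → Type v) (Ξ : Type w)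
    [MeasurableSpace Ξ] where
  val : (t : ℕ) → Fin H → Fin m → (Fin t → Traj H S A) → (Fin (t - 1) → ℕ → LayerSeed Ξ) → ℝ
  measurable_val : ∀ t h i τ, Measurable (val t h i τ)

variable (H S A) in
/-- Everything that specifies an execution of the framework: the game, the sampler of trajectories,
the subroutines, the potentials, and the number `R` of executions of `CCE-Approx`. -/
structure Framework (ν : Measure Ξ) where
  game : MarkovGame m H S A
  roll : Rollout game ν
  cce : CCEApprox S A Ξ
  vap : VApprox S A Ξ
  pot : Potential m H S A Ξ
  R : ℕ

/-- The sample space: the seed of the rollout of each epoch `t`, and the seeds of the layer `h` of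
each epoch `t`. -/
abbrev Seeds (Ξ : Type w) : Type w := (ℕ → Ξ) × (ℕ × ℕ → LayerSeed Ξ)

/-- All seeds are independent. -/
def seedLaw (ν : Measure Ξ) [IsProbabilityMeasure ν] : Measure (Seeds Ξ) :=
  (Measure.infinitePi fun _ : ℕ => ν).prod (Measure.infinitePi fun _ : ℕ × ℕ => layerLaw ν)

/-- At each state `s` of the layer, pick the policy and the gap estimates of the execution `r*(s)`
among the `R` executions that minimizes `∑ i, Gap_r^i(s)`. -/
def selectBest (h R : ℕ) (o : ℕ → LayerPolicy S A h × (S h → Fin m → ℝ)) :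
    LayerPolicy S A h × (S h → Fin m → ℝ) :=
  (fun s => (o (argminBelow (fun r => ∑ i, (o r).2 s i) R)).1 s,
   fun s => (o (argminBelow (fun r => ∑ i, (o r).2 s i) R)).2 s)

namespace Framework

variable {ν : Measure Ξ}

/-- The policy and the gap estimates for layer `h`, from `R` executions of `CCE-Approx`. -/
def layerChoice (F : Framework H S A ν) (h n : ℕ) (πbar : Fin n → Policy S A)
    (V : S (h + 1) → Fin m → ℝ) (K : ℕ) (ξ : ℕ → Ξ) : LayerPolicy S A h × (S h → Fin m → ℝ) :=
  selectBest h F.R fun r => F.cce.out h n πbar V K (ξ r)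

/-- The V-function for layer `h` that `V-Approx` returns. -/
def layerValue (F : Framework H S A ν) (h n : ℕ) (πbar : Fin n → Policy S A)
    (V : S (h + 1) → Fin m → ℝ) (K : ℕ) (x : LayerSeed Ξ) : S h → Fin m → ℝ :=
  F.vap.out h n πbar (F.layerChoice h n πbar V K x.1).1 V (F.layerChoice h n πbar V K x.1).2 K x.2

/-- The V-functions `V̄` of an update, computed backwards from the terminal layer; the first
argument is the number of layers that were already treated when `V̄` is completed on layer `h`. -/
def vbarFor (F : Framework H S A ν) (n : ℕ) (πbar : Fin n → Policy S A) (K : ℕ)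
    (x : ℕ → LayerSeed Ξ) : ℕ → (h : ℕ) → S h → Fin m → ℝ
  | 0, _ => 0
  | j + 1, h => F.layerValue h n πbar (F.vbarFor n πbar K x j (h + 1)) K (x h)

/-- The V-function `V̄` of an update on layer `h`; it is `0` on the terminal layer `H`. -/
def vbar (F : Framework H S A ν) (n : ℕ) (πbar : Fin n → Policy S A) (K : ℕ)
    (x : ℕ → LayerSeed Ξ) (h : ℕ) : S h → Fin m → ℝ :=
  F.vbarFor n πbar K x (H - h) h

/-- The policy that an update returns. -/
def newPolicy (F : Framework H S A ν) (n : ℕ) (πbar : Fin n → Policy S A) (K : ℕ)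
    (x : ℕ → LayerSeed Ξ) : Policy S A :=
  fun h => (F.layerChoice h n πbar (F.vbar n πbar K x (h + 1)) K (x h).1).1

/-- The potential `Ψ_{t,h}^i` when the policies of the epochs are `π`; in epoch `k + 1` the agents
play `π k`. -/
def potential (F : Framework H S A ν) (ω : Seeds Ξ) (π : ℕ → Policy S A) (t : ℕ) (h : Fin H)
    (i : Fin m) : ℝ :=
  F.pot.val t h i (fun k => F.roll.run (π k) (ω.1 (k + 1))) (fun k h => ω.2 (k + 1, h))

/-- What the framework keeps after an epoch: the policies so far, and the last update time `t₀`. -/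
structure State {m : ℕ} (S : ℕ → Type u) (A : Fin m → Type v) [∀ i, Fintype (A i)] where
  pol : ℕ → Policy S A
  last : ℕ

/-- The state after the epochs `1, …, t`. Only the entries `pol 0, …, pol t` are meaningful. -/
def state [∀ i, Nonempty (A i)] (F : Framework H S A ν) (ω : Seeds Ξ) : ℕ → State S A
  | 0 => ⟨fun _ _ _ => ProbVec.unif _, 0⟩
  | t + 1 => by
      classical
      exact
        let st := F.state ω t
        if st.last ≠ 0 ∧ ∀ h i,
            F.potential ω st.pol (t + 1) h i ≤ F.potential ω st.pol st.last h i + 1 then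
          ⟨Function.update st.pol (t + 1) (st.pol t), st.last⟩
        else
          ⟨Function.update st.pol (t + 1)
            (F.newPolicy (t + 1) (fun k => st.pol k) (t + 1) fun h => ω.2 (t + 1, h)), t + 1⟩

variable [∀ i, Nonempty (A i)]

/-- The policy `π̃_t` of epoch `t`. -/
def policy (F : Framework H S A ν) (ω : Seeds Ξ) (t : ℕ) : Policy S A := (F.state ω t).pol t

/-- The last epoch up to `t` in which the update was not lazy. -/
def lastUpdate (F : Framework H S A ν) (ω : Seeds Ξ) (t : ℕ) : ℕ := (F.state ω t).last

/-- The epochs among `1, …, T` with a non-lazy update. -/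
def updates (F : Framework H S A ν) (ω : Seeds Ξ) (T : ℕ) : Finset ℕ :=
  (Finset.Icc 1 T).filter fun t => F.lastUpdate ω t = t

/-- The V-function `V̄_t` on layer `h` in an epoch `t` with a non-lazy update. -/
def epochV (F : Framework H S A ν) (ω : Seeds Ξ) (t h : ℕ) : S h → Fin m → ℝ :=
  F.vbar t (fun k => F.policy ω k) t (fun h => ω.2 (t, h)) h

/-- `E_Gap[Gap_t^i(s)]`: the expected gap estimate of one execution of `CCE-Approx` on the inputs
of the epoch in which the policy `π̃_t` was computed, the inputs being held fixed. -/
def meanGap (F : Framework H S A ν) (ω : Seeds Ξ) (t h : ℕ) (s : S h) (i : Fin m) : ℝ :=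
  ∫ ξ, (F.cce.out h (F.lastUpdate ω t) (fun k => F.policy ω k)
    (F.epochV ω (F.lastUpdate ω t) (h + 1)) (F.lastUpdate ω t) ξ).2 s i ∂ν

/-- The number of samples in the layer `h` of an epoch `t` with a non-lazy update. -/
def layerCost (F : Framework H S A ν) (ω : Seeds Ξ) (t h : ℕ) : ℕ :=
  let πbar : Fin t → Policy S A := fun k => F.policy ω k
  let V := F.epochV ω t (h + 1)
  let c := F.layerChoice h t πbar V t (ω.2 (t, h)).1
  ∑ r ∈ Finset.range F.R, F.cce.cost h t πbar V t ((ω.2 (t, h)).1 r)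
    + F.vap.cost h t πbar c.1 V c.2 t (ω.2 (t, h)).2

/-- The total number of samples in the epochs `1, …, T`: one trajectory per epoch, and the calls
of the subroutines. -/
def samples (F : Framework H S A ν) (ω : Seeds Ξ) (T : ℕ) : ℕ :=
  T + ∑ t ∈ F.updates ω T, ∑ h ∈ Finset.range H, F.layerCost ω t h

end Framework

end Framework

/-! ### The conditions and the quantities of the conclusion -/

section Conditions

variable {m H : ℕ} {S : ℕ → Type u} {A : Fin m → Type v} {Ξ : Type w}
  [∀ h, Fintype (S h)] [∀ i, Fintype (A i)] [MeasurableSpace Ξ]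

/-- At every state of layer `h`, no agent gains more than `gap` by deviating from `π` when
the losses that follow are given by `V`. -/
def MarkovGame.GapBound (G : MarkovGame m H S A) (h : ℕ) (V : S (h + 1) → Fin m → ℝ)
    (π : LayerPolicy S A h) (gap : S h → Fin m → ℝ) : Prop :=
  ∀ (i : Fin m) (s : S h) (q : ProbVec (A i)),
    (π s).expect (G.bellman i h (fun s' => V s' i) s)
      - ((π s).deviate i q).expect (G.bellman i h (fun s' => V s' i) s) ≤ gap s i

/-- `Vhat` lies between `E - 2 gap` and `max (E - gap) 0`, where `E` is the one-step evaluation of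
`π` with respect to `V` (`0` is the least possible value of a V-function). -/
def MarkovGame.Optimistic (G : MarkovGame m H S A) (h : ℕ) (V : S (h + 1) → Fin m → ℝ)
    (π : LayerPolicy S A h) (gap Vhat : S h → Fin m → ℝ) : Prop :=
  ∀ (i : Fin m) (s : S h),
    Vhat s i ∈ Set.Icc
      ((π s).expect (G.bellman i h (fun s' => V s' i) s) - 2 * gap s i)
      (max ((π s).expect (G.bellman i h (fun s' => V s' i) s) - gap s i) 0)

namespace Framework

variable {ν : Measure Ξ}

/-- The gap estimates are nonnegative random variables with a finite expectation. -/
def GapRegular (F : Framework H S A ν) : Prop :=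
  ∀ (h n K : ℕ) (πbar : Fin n → Policy S A) (V : S (h + 1) → Fin m → ℝ) (s : S h) (i : Fin m),
    h < H → 1 ≤ n → 1 ≤ K →
      (∀ ξ, 0 ≤ (F.cce.out h n πbar V K ξ).2 s i) ∧
        Integrable (fun ξ => (F.cce.out h n πbar V K ξ).2 s i) ν

/-- Each call of `CCE-Approx` returns, with probability at least `1 - δ`, gap estimates that bound
the gain of a deviation. -/
def PerStateNoRegret (F : Framework H S A ν) (δ : ℝ) : Prop :=
  ∀ (h n K : ℕ) (πbar : Fin n → Policy S A) (V : S (h + 1) → Fin m → ℝ),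
    h < H → 1 ≤ n → 1 ≤ K →
      ν {ξ | ¬ F.game.GapBound h V (F.cce.out h n πbar V K ξ).1 (F.cce.out h n πbar V K ξ).2}
        ≤ ENNReal.ofReal δ

/-- `V-Approx`, called with the policy and the gap estimates that were selected from `R`
independent executions of `CCE-Approx` on the same inputs, returns an optimistic V-function with
probability at least `1 - δ`. -/
def OptimisticV [IsProbabilityMeasure ν] (F : Framework H S A ν) (δ : ℝ) : Prop :=
  ∀ (h n K : ℕ) (πbar : Fin n → Policy S A) (V : S (h + 1) → Fin m → ℝ),
    h < H → 1 ≤ n → 1 ≤ K →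
      layerLaw ν {x | ¬ F.game.Optimistic h V (F.layerChoice h n πbar V K x.1).1
        (F.layerChoice h n πbar V K x.1).2 (F.layerValue h n πbar V K x)} ≤ ENNReal.ofReal δ

/-- Almost surely, at most `d log T` of the epochs `1, …, T` have a non-lazy update. -/
def FewUpdates [IsProbabilityMeasure ν] [∀ i, Nonempty (A i)] (F : Framework H S A ν) (T : ℕ)
    (d : ℝ) : Prop :=
  ∀ᵐ ω ∂seedLaw ν, ((F.updates ω T).card : ℝ) ≤ d * Real.log T

/-- With probability at least `1 - δ`, the expected gap estimates, averaged over the states that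
`π̃_t` visits, sum up to at most `m √(L T log² (T / δ))` in each layer. -/
def PigeonHole [IsProbabilityMeasure ν] [∀ i, Nonempty (A i)] (F : Framework H S A ν) (T : ℕ)
    (δ L : ℝ) : Prop :=
  seedLaw ν {ω | ¬ ∀ h < H,
    ∑ t ∈ Finset.Icc 1 T, ∑ i : Fin m, ∑ s : S h,
        F.game.visit (F.policy ω t) h s * F.meanGap ω t h s i
      ≤ m * √(L * T * Real.log (T / δ) ^ 2)} ≤ ENNReal.ofReal δ

/-- One call of `CCE-Approx` uses at most `Γ₁ K` samples, one call of `V-Approx` at most `Γ₂ K`. -/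
def CostBound (F : Framework H S A ν) (Γ₁ Γ₂ : ℝ) : Prop :=
  (∀ h n πbar V K ξ, h < H → 1 ≤ n → 1 ≤ K → (F.cce.cost h n πbar V K ξ : ℝ) ≤ Γ₁ * K) ∧
  (∀ h n πbar π V gap K ξ, h < H → 1 ≤ n → 1 ≤ K →
    (F.vap.cost h n πbar π V gap K ξ : ℝ) ≤ Γ₂ * K)

/-- `R = ⌈log₂ (S / δ)⌉`, where `S` is the number of states in which actions are taken. -/
def numRuns (H : ℕ) (S : ℕ → Type u) [∀ h, Fintype (S h)] (δ : ℝ) : ℕ :=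
  ⌈Real.logb 2 ((∑ h ∈ Finset.range H, Fintype.card (S h) : ℕ) / δ)⌉₊

/-- The CCE-regret of the epochs `1, …, T`, summed over all agents. -/
def regret [∀ i, Nonempty (A i)] (F : Framework H S A ν) (ω : Seeds Ξ) (T : ℕ) : ℝ :=
  ∑ i : Fin m, ∑ t ∈ Finset.Icc 1 T,
    (F.game.value (F.policy ω t) i 0 F.game.init
      - F.game.bestResponse (F.policy ω t) i 0 F.game.init)

/-- The policies whose uniform mixture is the output of the framework. -/
def output [∀ i, Nonempty (A i)] (F : Framework H S A ν) (ω : Seeds Ξ) (T : ℕ) :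
    Fin (T + 1) → Policy S A :=
  fun t => F.policy ω t

end Framework

end Conditions

end

end AVLPR

/-! Consider one update in which, on every layer, `Gap` bounds the gain of each deviation and V̄ is
optimistic. Backward induction makes V̄ a lower bound for the value of every deviation
(`le_value_deviate`): the `Gap` subtracted in V̄ pays for the gain of deviating on that layer.
Against the value of the policy itself, V̄ loses at most 2 `Gap` per layer. Telescoping forward
along the visited states, the gain of a best response is at most the expected sum of 2 `Gap`
(`value_sub_bestResponse_le`).

The pigeon-hole condition speaks of mean gaps, not of the selected ones. By Markov's inequality a
single execution exceeds twice its mean gap sum at a given state with probability at most 1/2, and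
all `R` independent executions do so with probability at most 2^(-R); `R` is large enough to afford
this at all states (`layerLaw_not_layerGood_le`, `numRuns_spec`). The selection minimizes the sum
over agents, so only these sums are controlled.

The assumptions concern fixed inputs, whereas the inputs of an update are random. Resampling the
seeds of one layer of one epoch preserves the law and changes neither the inputs of that layer nor
the decision to update (`updateGood_reseed_iff`, `lastUpdate_reseed`), so the fixed-input bounds
hold conditionally (`seedLaw_inter_le`). Each epoch is weighted by its probability of an update; the
union bound thus costs the expected number of updates, at most `d * log T`, instead of `T`
(`sum_seedLaw_lastUpdate_le`). Lazy epochs inherit policy and gaps from their last update. Summing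
over epochs gives the regret bound, and `regret_bound_le` checks that the prescribed `T` brings the
average below ε. -/

namespace AVLPR
noncomputable section

/-! ### Expectations under finite probability vectors. -/

section Prelim

variable {α : Type*} [Fintype α]

theorem ProbVec.expect_mono (p : ProbVec α) {f g : α → ℝ} (h : ∀ a, f a ≤ g a) :
    p.expect f ≤ p.expect g :=
  Finset.sum_le_sum fun a _ => mul_le_mul_of_nonneg_left (h a) (p.2.1 a)

theorem ProbVec.expect_const (p : ProbVec α) (c : ℝ) : p.expect (fun _ => c) = c := by
  have h : ∑ a, p.1 a = 1 := p.2.2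
  simp [ProbVec.expect, ← Finset.sum_mul, h]

theorem ProbVec.expect_sub (p : ProbVec α) (f g : α → ℝ) :
    p.expect (fun a => f a - g a) = p.expect f - p.expect g := by
  simp [ProbVec.expect, mul_sub]

end Prelim

/-! ### Optimism, telescoping and equilibria in a fixed Markov game. -/

section Game

variable {m H : ℕ} {S : ℕ → Type u} {A : Fin m → Type v}
  [∀ h, Fintype (S h)] [∀ i, Fintype (A i)]

namespace MarkovGame

theorem bellman_mono (G : MarkovGame m H S A) (i : Fin m) (h : ℕ) {V W : S (h + 1) → ℝ}
    (hVW : ∀ s, V s ≤ W s) (s : S h) (a : ∀ i, A i) :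
    G.bellman i h V s a ≤ G.bellman i h W s a :=
  add_le_add le_rfl (ProbVec.expect_mono _ hVW)

theorem bellman_sub (G : MarkovGame m H S A) (i : Fin m) (h : ℕ) (V W : S (h + 1) → ℝ)
    (s : S h) (a : ∀ i, A i) :
    G.bellman i h V s a - G.bellman i h W s a
      = (G.trans h s a).expect fun s' => V s' - W s' := by
  simp [bellman, ProbVec.expect_sub]

theorem valueFor_nonneg (G : MarkovGame m H S A) (π : Policy S A) (i : Fin m) (n h : ℕ)
    (s : S h) : 0 ≤ G.valueFor π i n h s := by
  induction n generalizing h with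
  | zero => simp [valueFor]
  | succ n ih =>
    refine Finset.sum_nonneg fun a _ => mul_nonneg ((π h s).2.1 a) ?_
    exact add_nonneg (G.loss_mem i h s a).1
      (Finset.sum_nonneg fun s' _ => mul_nonneg ((G.trans h s a).2.1 s') (ih _ _))

theorem valueFor_le (G : MarkovGame m H S A) (π : Policy S A) (i : Fin m) (n h : ℕ)
    (s : S h) : G.valueFor π i n h s ≤ n := by
  induction n generalizing h with
  | zero => simp [valueFor]
  | succ n ih =>
    have hb : ∀ a, G.bellman i h (G.valueFor π i n (h + 1)) s a ≤ n + 1 := fun a => by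
      have h1 := (G.loss_mem i h s a).2
      have h2 := ProbVec.expect_mono (G.trans h s a) (ih (h + 1))
      rw [ProbVec.expect_const] at h2
      unfold bellman
      linarith
    calc _ ≤ (π h s).expect (fun _ => (n + 1 : ℝ)) := ProbVec.expect_mono _ hb
      _ = _ := by rw [ProbVec.expect_const]; push_cast; rfl

theorem value_nonneg (G : MarkovGame m H S A) (π : Policy S A) (i : Fin m) (h : ℕ)
    (s : S h) : 0 ≤ G.value π i h s := G.valueFor_nonneg π i _ h s

theorem value_terminal (G : MarkovGame m H S A) (π : Policy S A) (i : Fin m) (s : S H) :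
    G.value π i H s = 0 := by
  simp [value, valueFor]

theorem value_step (G : MarkovGame m H S A) (π : Policy S A) (i : Fin m) {h : ℕ} (hh : h < H)
    (s : S h) :
    G.value π i h s = (π h s).expect (G.bellman i h (G.value π i (h + 1)) s) := by
  have : H - h = (H - (h + 1)) + 1 := by omega
  rw [value, this]
  rfl

theorem bddBelow_value_deviate (G : MarkovGame m H S A) (π : Policy S A) (i : Fin m) (h : ℕ)
    (s : S h) :
    BddBelow (Set.range fun q : AgentPolicy S A i => G.value (deviatePolicy π i q) i h s) :=
  ⟨0, by rintro _ ⟨q, rfl⟩; exact G.value_nonneg _ _ _ _⟩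

theorem visit_nonneg (G : MarkovGame m H S A) (π : Policy S A) (h : ℕ) (s : S h) :
    0 ≤ G.visit π h s := by
  induction h with
  | zero => simp only [visit]; split_ifs <;> norm_num
  | succ h ih =>
    exact Finset.sum_nonneg fun s' _ => mul_nonneg (ih s')
      (Finset.sum_nonneg fun a _ => mul_nonneg ((π h s').2.1 a) ((G.trans h s' a).2.1 s))

theorem sum_visit_zero (G : MarkovGame m H S A) (π : Policy S A) (f : S 0 → ℝ) :
    ∑ s, G.visit π 0 s * f s = f G.init := by
  classical
  simp [visit]

theorem sum_visit_succ (G : MarkovGame m H S A) (π : Policy S A) (h : ℕ) (f : S (h + 1) → ℝ) :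
    ∑ s, G.visit π (h + 1) s * f s
      = ∑ s, G.visit π h s * (π h s).expect fun a => (G.trans h s a).expect f := by
  simp only [visit, ProbVec.expect, Finset.sum_mul, Finset.mul_sum]
  rw [Finset.sum_comm]
  refine Finset.sum_congr rfl fun s _ => ?_
  rw [Finset.sum_comm]
  exact Finset.sum_congr rfl fun a _ => Finset.sum_congr rfl fun s' _ => by ring

/-- Optimistic V-functions are lower bounds for the value of every deviation. -/
theorem le_value_deviate (G : MarkovGame m H S A) {π : Policy S A}
    {V gap : (h : ℕ) → S h → Fin m → ℝ} (hV : V H = 0)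
    (hgap : ∀ h < H, G.GapBound h (V (h + 1)) (π h) (gap h))
    (hopt : ∀ h < H, G.Optimistic h (V (h + 1)) (π h) (gap h) (V h))
    (i : Fin m) (q : AgentPolicy S A i) {h : ℕ} (hh : h ≤ H) (s : S h) :
    V h s i ≤ G.value (deviatePolicy π i q) i h s := by
  induction hh using Nat.decreasingInduction with
  | self => simp [hV, value_terminal]
  | of_succ h hh ih =>
    -- Truncation at 0 in the optimistic upper bound is harmless because values are nonnegative; in
    -- the other branch `Gap` absorbs the gain of the one-step deviation.
    refine ((hopt h hh i s).2).trans (max_le ?_ (G.value_nonneg _ _ _ _))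
    rw [value_step _ _ _ hh]
    have h1 := hgap h hh i s (q h s)
    have h2 : ((deviatePolicy π i q) h s).expect (G.bellman i h (fun s' => V (h + 1) s' i) s)
        ≤ ((deviatePolicy π i q) h s).expect
          (G.bellman i h (G.value (deviatePolicy π i q) i (h + 1)) s) :=
      ProbVec.expect_mono _ fun a => G.bellman_mono i h ih s a
    simp only [deviatePolicy] at h1 h2 ⊢
    linarith

/-- The gain of the best response is at most twice the expected sum of the gaps. -/
theorem value_sub_bestResponse_le [∀ i, Nonempty (A i)] (G : MarkovGame m H S A) {π : Policy S A}
    {V gap : (h : ℕ) → S h → Fin m → ℝ} (hV : V H = 0)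
    (hgap : ∀ h < H, G.GapBound h (V (h + 1)) (π h) (gap h))
    (hopt : ∀ h < H, G.Optimistic h (V (h + 1)) (π h) (gap h) (V h)) (i : Fin m) :
    G.value π i 0 G.init - G.bestResponse π i 0 G.init
      ≤ ∑ h ∈ Finset.range H, ∑ s, G.visit π h s * (2 * gap h s i) := by
  have hbest : V 0 G.init i ≤ G.bestResponse π i 0 G.init := by
    have : Nonempty (AgentPolicy S A i) := ⟨fun _ _ => ProbVec.unif _⟩
    exact le_ciInf fun q => G.le_value_deviate hV hgap hopt i q (Nat.zero_le H) _
  -- Telescoping: after `n` layers the excess of the value over `V` is the gaps paid so far plus the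
  -- expected excess on layer `n`. The remainder vanishes at `n = H`, where both functions are 0.
  have key : ∀ n ≤ H, G.value π i 0 G.init - V 0 G.init i
      ≤ ∑ h ∈ Finset.range n, ∑ s, G.visit π h s * (2 * gap h s i)
        + ∑ s, G.visit π n s * (G.value π i n s - V n s i) := by
    intro n
    induction n with
    | zero => intro _; simp [sum_visit_zero G π fun s => G.value π i 0 s - V 0 s i]
    | succ n ih =>
      intro hn
      refine (ih (by omega)).trans ?_
      rw [Finset.sum_range_succ, add_assoc, sum_visit_succ, ← Finset.sum_add_distrib]
      refine add_le_add le_rfl (Finset.sum_le_sum fun s _ => ?_)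
      rw [← mul_add]
      refine mul_le_mul_of_nonneg_left ?_ (G.visit_nonneg π n s)
      have h1 := (hopt n (by omega) i s).1
      rw [value_step _ _ _ (by omega)]
      have h2 : (fun a => (G.trans n s a).expect fun s' =>
          G.value π i (n + 1) s' - V (n + 1) s' i) = fun a =>
          G.bellman i n (G.value π i (n + 1)) s a
            - G.bellman i n (fun s' => V (n + 1) s' i) s a :=
        funext fun a => (G.bellman_sub i n _ (fun s' => V (n + 1) s' i) s a).symm
      rw [h2, ProbVec.expect_sub]
      linarith
  have h := key H le_rfl
  simp only [value_terminal, hV, Pi.zero_apply, sub_zero, mul_zero, Finset.sum_const_zero,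
    add_zero] at h
  linarith

/-- An uninformed deviation uses the same policy for every index, and the infimum of an average is
at least the average of the infima. -/
theorem isCCE_of_isInformedCCE [∀ i, Nonempty (A i)] (G : MarkovGame m H S A) {n : ℕ}
    {π : Fin n → Policy S A} {ε : ℝ} (h : G.IsInformedCCE π ε) : G.IsCCE π ε := by
  intro i
  refine le_trans ?_ (h i)
  rw [Finset.sum_sub_distrib, mul_sub]
  refine sub_le_sub_left ?_ _
  have : Nonempty (AgentPolicy S A i) := ⟨fun _ _ => ProbVec.unif _⟩
  refine le_ciInf fun q => mul_le_mul_of_nonneg_left ?_ (by positivity)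
  exact Finset.sum_le_sum fun k _ => ciInf_le (G.bddBelow_value_deviate _ _ _ _) q

/-- Needed for the uniform policy of index 0, which belongs to the output but is not covered by the
regret of the epochs from 1 on. -/
theorem value_sub_bestResponse_le_horizon [∀ i, Nonempty (A i)] (G : MarkovGame m H S A)
    (π : Policy S A) (i : Fin m) :
    G.value π i 0 G.init - G.bestResponse π i 0 G.init ≤ H := by
  have : Nonempty (AgentPolicy S A i) := ⟨fun _ _ => ProbVec.unif _⟩
  have h1 : 0 ≤ G.bestResponse π i 0 G.init := le_ciInf fun q => G.value_nonneg _ _ _ _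
  have h2 : G.value π i 0 G.init ≤ H := G.valueFor_le π i H 0 G.init
  linarith

/-- `GapBound` only has to be checked for deterministic deviations. -/
theorem gapBound_iff (G : MarkovGame m H S A) (h : ℕ) (V : S (h + 1) → Fin m → ℝ)
    (π : LayerPolicy S A h) (gap : S h → Fin m → ℝ) :
    G.GapBound h V π gap ↔ ∀ (i : Fin m) (s : S h) (c : A i),
      (π s).expect (G.bellman i h (fun s' => V s' i) s)
        - ∑ a : ∀ i, A i, (Set.indicator {a : ∀ i, A i | a i = c} 1 a *
            ∑ b : A i, by classical exact (π s).1 (Function.update a i b)) *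
          G.bellman i h (fun s' => V s' i) s a ≤ gap s i := by
  classical
  constructor
  · intro H i s c
    refine le_trans (le_of_eq ?_) (H i s ⟨Pi.single c 1, single_mem_stdSimplex ℝ c⟩)
    congr 1
    refine Finset.sum_congr rfl fun a _ => ?_
    simp only [ProbVec.deviate]
    congr 2
    by_cases hc : a i = c <;> simp [Set.indicator, hc]
  · intro H i s q
    have hq : ∑ c, q.1 c = 1 := q.2.2
    set f := G.bellman i h (fun s' => V s' i) s
    set D : A i → ℝ := fun c => ∑ a : ∀ i, A i, (Set.indicator {a : ∀ i, A i | a i = c} 1 a *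
            ∑ b : A i, (π s).1 (Function.update a i b)) * f a with hD
    -- The loss after a deviation is linear in `q`, hence the `q`-average of the losses `D c` of the
    -- pure deviations.
    have h1 : ((π s).deviate i q).expect f = ∑ c, q.1 c * D c := by
      simp only [hD, Finset.mul_sum (s := (Finset.univ : Finset (∀ i, A i)))]
      rw [Finset.sum_comm]
      refine Finset.sum_congr rfl fun a _ => ?_
      rw [Finset.sum_eq_single (a i)]
      · simp only [ProbVec.deviate, Set.indicator, Set.mem_ofPred_eq, if_true, Pi.one_apply,
          one_mul, ← mul_assoc]
      · intro c _ hc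
        simp [Set.indicator, Ne.symm hc]
      · simp
    rw [h1]
    have h2 : (π s).expect f - ∑ c, q.1 c * D c = ∑ c, q.1 c * ((π s).expect f - D c) := by
      simp [mul_sub, ← Finset.sum_mul, hq]
    rw [h2]
    calc _ ≤ ∑ c, q.1 c * gap s i := Finset.sum_le_sum fun c _ =>
          mul_le_mul_of_nonneg_left (by convert H i s c) (q.2.1 c)
      _ = gap s i := by rw [← Finset.sum_mul, hq, one_mul]

end MarkovGame
end Game

/-! ### Structure of an execution, and which seeds each quantity depends on. -/

section Framework

variable {m H : ℕ} {S : ℕ → Type u} {A : Fin m → Type v} {Ξ : Type w}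
  [∀ h, Fintype (S h)] [∀ i, Fintype (A i)] [MeasurableSpace Ξ]

namespace Framework

variable {ν : Measure Ξ}

/-- The recursion runs backwards and never looks at earlier layers. In particular the V-function fed
into layer `h` is independent of the seeds of layer `h`. -/
theorem vbarFor_congr (F : Framework H S A ν) (n : ℕ) (πbar : Fin n → Policy S A) (K : ℕ)
    {x y : ℕ → LayerSeed Ξ} (j h : ℕ) (hxy : ∀ k, h ≤ k → x k = y k) :
    F.vbarFor n πbar K x j h = F.vbarFor n πbar K y j h := by
  induction j generalizing h with
  | zero => rfl
  | succ j ih =>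
    simp only [vbarFor]
    rw [ih (h + 1) fun k hk => hxy k (by omega), hxy h le_rfl]

theorem vbar_congr (F : Framework H S A ν) (n : ℕ) (πbar : Fin n → Policy S A) (K : ℕ)
    {x y : ℕ → LayerSeed Ξ} (h : ℕ) (hxy : ∀ k, h ≤ k → x k = y k) :
    F.vbar n πbar K x h = F.vbar n πbar K y h :=
  F.vbarFor_congr n πbar K _ h hxy

theorem vbar_terminal (F : Framework H S A ν) (n : ℕ) (πbar : Fin n → Policy S A) (K : ℕ)
    (x : ℕ → LayerSeed Ξ) : F.vbar n πbar K x H = 0 := by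
  simp [vbar, vbarFor]

theorem vbar_step (F : Framework H S A ν) (n : ℕ) (πbar : Fin n → Policy S A) (K : ℕ)
    (x : ℕ → LayerSeed Ξ) {h : ℕ} (hh : h < H) :
    F.vbar n πbar K x h = F.layerValue h n πbar (F.vbar n πbar K x (h + 1)) K (x h) := by
  have : H - h = (H - (h + 1)) + 1 := by omega
  rw [vbar, this]
  rfl

variable [∀ i, Nonempty (A i)]

/-- The update of epoch `t + 1` is not lazy. -/
def UpdatesAfter (F : Framework H S A ν) (ω : Seeds Ξ) (t : ℕ) : Prop :=
  ¬ ((F.state ω t).last ≠ 0 ∧ ∀ h i, F.potential ω (F.state ω t).pol (t + 1) h i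
    ≤ F.potential ω (F.state ω t).pol (F.state ω t).last h i + 1)

theorem state_succ_of_lazy (F : Framework H S A ν) {ω : Seeds Ξ} {t : ℕ}
    (h : ¬ F.UpdatesAfter ω t) :
    F.state ω (t + 1) = ⟨Function.update (F.state ω t).pol (t + 1) ((F.state ω t).pol t),
      (F.state ω t).last⟩ := by
  rw [UpdatesAfter, not_not] at h
  rw [state]
  exact if_pos h

theorem state_succ_of_update (F : Framework H S A ν) {ω : Seeds Ξ} {t : ℕ}
    (h : F.UpdatesAfter ω t) :
    F.state ω (t + 1) = ⟨Function.update (F.state ω t).pol (t + 1)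
      (F.newPolicy (t + 1) (fun k => (F.state ω t).pol k) (t + 1) fun h => ω.2 (t + 1, h)),
      t + 1⟩ := by
  rw [UpdatesAfter] at h
  rw [state]
  exact if_neg h

theorem lastUpdate_le (F : Framework H S A ν) (ω : Seeds Ξ) (t : ℕ) : F.lastUpdate ω t ≤ t := by
  induction t with
  | zero => rfl
  | succ t ih =>
    unfold lastUpdate at ih ⊢
    by_cases h : F.UpdatesAfter ω t
    · rw [F.state_succ_of_update h]
    · rw [F.state_succ_of_lazy h]
      exact ih.trans t.le_succ

theorem lastUpdate_succ_eq_iff (F : Framework H S A ν) (ω : Seeds Ξ) (t : ℕ) :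
    F.lastUpdate ω (t + 1) = t + 1 ↔ F.UpdatesAfter ω t := by
  by_cases h : F.UpdatesAfter ω t
  · simp [lastUpdate, F.state_succ_of_update h, h]
  · have := F.lastUpdate_le ω t
    simp only [lastUpdate, F.state_succ_of_lazy h, h, iff_false] at this ⊢
    omega

/-- The initial value 0 of `last` rules out laziness in epoch 1. -/
theorem lastUpdate_one (F : Framework H S A ν) (ω : Seeds Ξ) : F.lastUpdate ω 1 = 1 :=
  (F.lastUpdate_succ_eq_iff ω 0).2 (by simp [UpdatesAfter, state])

/-- Epoch `t + 1` writes entry `t + 1` only, so earlier entries are final. -/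
theorem state_pol (F : Framework H S A ν) (ω : Seeds Ξ) {k t : ℕ} (hk : k ≤ t) :
    (F.state ω t).pol k = F.policy ω k := by
  induction hk with
  | refl => rfl
  | @step t hk ih =>
    have hne : k ≠ t + 1 := by have := Nat.le_of_lt_succ (Nat.lt_succ_of_le hk); omega
    rw [← ih]
    by_cases h : F.UpdatesAfter ω t
    · simp [F.state_succ_of_update h, Function.update_of_ne hne]
    · simp [F.state_succ_of_lazy h, Function.update_of_ne hne]

theorem policy_succ_of_lazy (F : Framework H S A ν) {ω : Seeds Ξ} {t : ℕ}
    (h : ¬ F.UpdatesAfter ω t) : F.policy ω (t + 1) = F.policy ω t := by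
  simp [policy, F.state_succ_of_lazy h]

theorem policy_of_update (F : Framework H S A ν) {ω : Seeds Ξ} {t : ℕ} (ht : 1 ≤ t)
    (h : F.lastUpdate ω t = t) : F.policy ω t
      = F.newPolicy t (fun k => F.policy ω k) t fun h => ω.2 (t, h) := by
  obtain ⟨t, rfl⟩ : ∃ s, t = s + 1 := ⟨t - 1, by omega⟩
  have hp : (fun k : Fin (t + 1) => (F.state ω t).pol k)
      = fun k : Fin (t + 1) => F.policy ω k :=
    funext fun k => F.state_pol ω (Nat.le_of_lt_succ k.2)
  rw [policy, F.state_succ_of_update ((F.lastUpdate_succ_eq_iff ω t).1 h), hp]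
  simp

/-- A lazy epoch copies both the policy and the update time. This reduces statements about any epoch
to epochs with an update. -/
theorem lastUpdate_spec (F : Framework H S A ν) (ω : Seeds Ξ) {t : ℕ} (ht : 1 ≤ t) :
    1 ≤ F.lastUpdate ω t ∧ F.lastUpdate ω (F.lastUpdate ω t) = F.lastUpdate ω t ∧
      F.policy ω t = F.policy ω (F.lastUpdate ω t) := by
  induction ht with
  | refl => simp [lastUpdate_one]
  | @step t ht ih =>
    by_cases h : F.UpdatesAfter ω t
    · have h1 := (F.lastUpdate_succ_eq_iff ω t).2 h
      simp [h1]
    · have h1 : F.lastUpdate ω (t + 1) = F.lastUpdate ω t := by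
        simp [lastUpdate, F.state_succ_of_lazy h]
      simpa [h1, F.policy_succ_of_lazy h] using ih

/-- The expected gap estimate of one execution of `CCE-Approx` on the inputs of an update in
epoch `t`. -/
def updateMeanGap (F : Framework H S A ν) (ω : Seeds Ξ) (t h : ℕ) (s : S h) (i : Fin m) : ℝ :=
  ∫ ξ, (F.cce.out h t (fun k => F.policy ω k) (F.epochV ω t (h + 1)) t ξ).2 s i ∂ν

theorem meanGap_eq (F : Framework H S A ν) (ω : Seeds Ξ) (t h : ℕ) (s : S h) (i : Fin m) :
    F.meanGap ω t h s i = F.updateMeanGap ω (F.lastUpdate ω t) h s i := rfl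

theorem updatesAfter_congr (F : Framework H S A ν) {ω ω' : Seeds Ξ} (h1 : ω.1 = ω'.1) {t : ℕ}
    (h2 : ∀ k ≤ t, ∀ h, ω.2 (k, h) = ω'.2 (k, h)) (hst : F.state ω t = F.state ω' t) :
    F.UpdatesAfter ω t ↔ F.UpdatesAfter ω' t := by
  -- The potential of epoch `n` sees subroutine seeds only up to epoch `n - 1`, so the decision in
  -- epoch `t + 1` is made before that epoch's calls.
  have hpot : ∀ n ≤ t + 1, ∀ pol h i, F.potential ω pol n h i = F.potential ω' pol n h i := by
    intro n hn pol h i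
    have : (fun (k : Fin (n - 1)) h => ω.2 (k + 1, h))
        = fun (k : Fin (n - 1)) h => ω'.2 (k + 1, h) :=
      funext fun k => funext fun h => h2 _ (by omega) h
    simp only [potential, h1]
    exact congrArg _ this
  have hl := F.lastUpdate_le ω' t
  unfold lastUpdate at hl
  simp only [UpdatesAfter, hst, hpot (t + 1) le_rfl, hpot _ (hl.trans t.le_succ)]

/-- The state after `t` epochs does not depend on the seeds of the subroutine calls of later
epochs. -/
theorem state_congr (F : Framework H S A ν) {ω ω' : Seeds Ξ} (h1 : ω.1 = ω'.1) (t : ℕ)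
    (h2 : ∀ k ≤ t, ∀ h, ω.2 (k, h) = ω'.2 (k, h)) : F.state ω t = F.state ω' t := by
  induction t with
  | zero => rfl
  | succ t ih =>
    have h3 : ∀ k ≤ t, ∀ h, ω.2 (k, h) = ω'.2 (k, h) := fun k hk => h2 k (by omega)
    have ih := ih h3
    by_cases h : F.UpdatesAfter ω t
    · rw [F.state_succ_of_update h,
        F.state_succ_of_update ((F.updatesAfter_congr h1 h3 ih).1 h), ih]
      simp only [h2 (t + 1) le_rfl]
    · rw [F.state_succ_of_lazy h,
        F.state_succ_of_lazy (mt (F.updatesAfter_congr h1 h3 ih).2 h), ih]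

theorem policy_congr (F : Framework H S A ν) {ω ω' : Seeds Ξ} (h1 : ω.1 = ω'.1) (t : ℕ)
    (h2 : ∀ k ≤ t, ∀ h, ω.2 (k, h) = ω'.2 (k, h)) : F.policy ω t = F.policy ω' t := by
  rw [policy, policy, F.state_congr h1 t h2]

end Framework
end Framework

/-! ### Measurability of the execution as a function of the seeds. -/

theorem measurable_eval_nat {Ω β : Type*} [MeasurableSpace Ω] [MeasurableSpace β]
    {f : ℕ → Ω → β} (hf : ∀ n, Measurable (f n)) {N : Ω → ℕ} (hN : Measurable N) :
    Measurable fun ω => f (N ω) ω :=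
  (measurable_from_prod_countable_left (f := fun p : Ω × ℕ => f p.2 p.1) hf).comp
    (measurable_id.prodMk hN)

theorem measurable_argminBelow {Ω : Type*} [MeasurableSpace Ω] {f : Ω → ℕ → ℝ}
    (hf : ∀ r, Measurable fun ω => f ω r) (n : ℕ) :
    Measurable fun ω => argminBelow (f ω) n := by
  induction n with
  | zero => exact measurable_const
  | succ n ih =>
    exact Measurable.ite
      (measurableSet_lt (hf n) (measurable_eval_nat (f := fun n ω => f ω n) hf ih))
      measurable_const ih

section Framework

variable {m H : ℕ} {S : ℕ → Type u} {A : Fin m → Type v} {Ξ : Type w}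
  [∀ h, Fintype (S h)] [∀ i, Fintype (A i)] [MeasurableSpace Ξ]

theorem measurable_selectBest {Ω : Type*} [MeasurableSpace Ω] (h R : ℕ)
    {o : Ω → ℕ → LayerPolicy S A h × (S h → Fin m → ℝ)}
    (ho : ∀ r, Measurable fun ω => o ω r) : Measurable fun ω => selectBest h R (o ω) := by
  have hN : ∀ s, Measurable fun ω => argminBelow (fun r => ∑ i, (o ω r).2 s i) R := fun s =>
    measurable_argminBelow (fun r => Finset.measurable_sum _ fun i _ => by
      have := ho r
      fun_prop) R
  refine Measurable.prodMk ?_ ?_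
  · refine measurable_pi_lambda _ fun s => ?_
    exact measurable_eval_nat (f := fun r ω => (o ω r).1 s)
      (fun r => (measurable_pi_apply s).comp (ho r).fst) (hN s)
  · refine measurable_pi_lambda _ fun s => ?_
    exact measurable_eval_nat (f := fun r ω => (o ω r).2 s)
      (fun r => (measurable_pi_apply s).comp (ho r).snd) (hN s)

namespace Framework

variable {ν : Measure Ξ} {Ω : Type*} [MeasurableSpace Ω]

theorem measurable_layerChoice (F : Framework H S A ν) (h n K : ℕ) {p : Ω → Fin n → Policy S A}
    {V : Ω → S (h + 1) → Fin m → ℝ} {ξ : Ω → ℕ → Ξ} (hp : Measurable p) (hV : Measurable V)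
    (hξ : Measurable ξ) :
    Measurable fun ω => F.layerChoice h n (p ω) (V ω) K (ξ ω) :=
  measurable_selectBest h F.R fun r => (F.cce.measurable_out h n K).comp
    (hp.prodMk (hV.prodMk ((measurable_pi_apply r).comp hξ)))

theorem measurable_layerValue (F : Framework H S A ν) (h n K : ℕ) {p : Ω → Fin n → Policy S A}
    {V : Ω → S (h + 1) → Fin m → ℝ} {x : Ω → LayerSeed Ξ} (hp : Measurable p) (hV : Measurable V)
    (hx : Measurable x) :
    Measurable fun ω => F.layerValue h n (p ω) (V ω) K (x ω) := by
  have hc := F.measurable_layerChoice h n K hp hV hx.fst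
  exact (F.vap.measurable_out h n K).comp
    (hp.prodMk (hc.fst.prodMk (hV.prodMk (hc.snd.prodMk hx.snd))))

theorem measurable_vbarFor (F : Framework H S A ν) (n K : ℕ) {p : Ω → Fin n → Policy S A}
    {x : Ω → ℕ → LayerSeed Ξ} (hp : Measurable p) (hx : Measurable x) (j h : ℕ) :
    Measurable fun ω => F.vbarFor n (p ω) K (x ω) j h := by
  induction j generalizing h with
  | zero => exact measurable_const
  | succ j ih =>
    exact F.measurable_layerValue h n K hp (ih (h + 1)) ((measurable_pi_apply h).comp hx)

theorem measurable_vbar (F : Framework H S A ν) (n K : ℕ) {p : Ω → Fin n → Policy S A}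
    {x : Ω → ℕ → LayerSeed Ξ} (hp : Measurable p) (hx : Measurable x) (h : ℕ) :
    Measurable fun ω => F.vbar n (p ω) K (x ω) h :=
  F.measurable_vbarFor n K hp hx _ h

theorem measurable_newPolicy (F : Framework H S A ν) (n K : ℕ) {p : Ω → Fin n → Policy S A}
    {x : Ω → ℕ → LayerSeed Ξ} (hp : Measurable p) (hx : Measurable x) :
    Measurable fun ω => F.newPolicy n (p ω) K (x ω) :=
  measurable_pi_lambda _ fun h => (F.measurable_layerChoice h n K hp
    (F.measurable_vbar n K hp hx (h + 1)) ((measurable_pi_apply h).comp hx).fst).fst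

theorem measurable_potential (F : Framework H S A ν) {pol : Seeds Ξ → ℕ → Policy S A} (t : ℕ)
    (h : Fin H) (i : Fin m) (hpol : ∀ k < t, Measurable fun ω => pol ω k) :
    Measurable fun ω => F.potential ω (pol ω) t h i := by
  classical
  let g : Seeds Ξ → Fin t → Traj H S A := fun ω k => F.roll.run (pol ω k) (ω.1 (k + 1))
  have hg : ∀ τ, MeasurableSet (g ⁻¹' {τ}) := fun τ => by
    have : g ⁻¹' {τ} = ⋂ k : Fin t, {ω | F.roll.run (pol ω k) (ω.1 (k + 1)) = τ k} := by
      ext ω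
      simp [g, funext_iff]
    rw [this]
    refine MeasurableSet.iInter fun k => ?_
    have hk : Measurable fun ω : Seeds Ξ => (pol ω k, ω.1 (k + 1)) :=
      (hpol k k.2).prodMk ((measurable_pi_apply _).comp measurable_fst)
    exact hk (F.roll.measurable_run (τ k))
  -- Trajectories take finitely many values, so measurable level sets suffice and the potential may
  -- be treated one value at a time.
  let _ : MeasurableSpace (Fin t → Traj H S A) := ⊤
  have : DiscreteMeasurableSpace (Fin t → Traj H S A) := ⟨fun _ => trivial⟩
  have hgm : Measurable g := measurable_to_countable' hg
  have hs : Measurable fun ω : Seeds Ξ =>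
      (fun (k : Fin (t - 1)) (h : ℕ) => ω.2 ((k : ℕ) + 1, h)) := by
    refine measurable_pi_lambda _ fun k => measurable_pi_lambda _ fun h => ?_
    exact (measurable_pi_apply _).comp measurable_snd
  exact (measurable_from_prod_countable_left
    (f := fun p : (Fin (t - 1) → ℕ → LayerSeed Ξ) × (Fin t → Traj H S A) =>
      F.pot.val t h i p.2 p.1) fun τ => F.pot.measurable_val t h i τ).comp (hs.prodMk hgm)

variable [∀ i, Nonempty (A i)]

theorem measurableSet_updatesAfter (F : Framework H S A ν) {t : ℕ}
    (hpol : ∀ k, Measurable fun ω => (F.state ω t).pol k)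
    (hlast : Measurable fun ω => (F.state ω t).last) :
    MeasurableSet {ω | F.UpdatesAfter ω t} := by
  refine MeasurableSet.compl (MeasurableSet.inter ?_ ?_)
  · exact (hlast (measurableSet_singleton 0)).compl
  · have : {ω | ∀ h i, F.potential ω (F.state ω t).pol (t + 1) h i
        ≤ F.potential ω (F.state ω t).pol (F.state ω t).last h i + 1}
        = ⋂ h, ⋂ i, {ω | F.potential ω (F.state ω t).pol (t + 1) h i
          ≤ F.potential ω (F.state ω t).pol (F.state ω t).last h i + 1} := by
      ext; simp
    change MeasurableSet {ω | ∀ h i, F.potential ω (F.state ω t).pol (t + 1) h i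
        ≤ F.potential ω (F.state ω t).pol (F.state ω t).last h i + 1}
    rw [this]
    refine MeasurableSet.iInter fun h => MeasurableSet.iInter fun i => ?_
    refine measurableSet_le (F.measurable_potential _ h i fun k _ => hpol k) ?_
    exact (measurable_eval_nat (f := fun n ω => F.potential ω (F.state ω t).pol n h i)
      (fun n => F.measurable_potential _ h i fun k _ => hpol k) hlast).add_const 1

theorem measurable_state (F : Framework H S A ν) (t : ℕ) :
    (∀ k, Measurable fun ω => (F.state ω t).pol k) ∧ Measurable fun ω => (F.state ω t).last := by
  classical
  induction t with
  | zero => exact ⟨fun k => measurable_const, measurable_const⟩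
  | succ t ih =>
    have hU := F.measurableSet_updatesAfter ih.1 ih.2
    constructor
    · intro k
      have hnew : Measurable fun ω : Seeds Ξ => F.newPolicy (t + 1)
          (fun k : Fin (t + 1) => (F.state ω t).pol k) (t + 1) fun h => ω.2 (t + 1, h) :=
        F.measurable_newPolicy (t + 1) (t + 1) (measurable_pi_lambda _ fun k => ih.1 k)
          (measurable_pi_lambda _ fun _ => (measurable_pi_apply _).comp measurable_snd)
      have : (fun ω => (F.state ω (t + 1)).pol k) = fun ω => if k = t + 1 then
          (if F.UpdatesAfter ω t then F.newPolicy (t + 1)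
            (fun k : Fin (t + 1) => (F.state ω t).pol k) (t + 1) fun h => ω.2 (t + 1, h)
            else (F.state ω t).pol t) else (F.state ω t).pol k := by
        funext ω
        by_cases h : F.UpdatesAfter ω t
        · simp [F.state_succ_of_update h, h, Function.update_apply]
        · simp [F.state_succ_of_lazy h, h, Function.update_apply]
      rw [this]
      split_ifs
      · exact Measurable.ite hU hnew (ih.1 t)
      · exact ih.1 k
    · have : (fun ω => (F.state ω (t + 1)).last)
          = fun ω => if F.UpdatesAfter ω t then t + 1 else (F.state ω t).last := by
        funext ω
        by_cases h : F.UpdatesAfter ω t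
        · simp [F.state_succ_of_update h, h]
        · simp [F.state_succ_of_lazy h, h]
      rw [this]
      exact Measurable.ite hU measurable_const ih.2

theorem measurable_policy (F : Framework H S A ν) (t : ℕ) : Measurable fun ω => F.policy ω t :=
  (F.measurable_state t).1 t

theorem measurableSet_lastUpdate_eq (F : Framework H S A ν) (t : ℕ) :
    MeasurableSet {ω | F.lastUpdate ω t = t} :=
  (F.measurable_state t).2 (measurableSet_singleton t)

theorem measurable_epochV (F : Framework H S A ν) (t h : ℕ) :
    Measurable fun ω => F.epochV ω t h :=
  F.measurable_vbar t t (measurable_pi_lambda _ fun k => F.measurable_policy k)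
    (measurable_pi_lambda _ fun _ => (measurable_pi_apply _).comp measurable_snd) h

end Framework

end Framework

/-! ### Resampling seeds, and boosting by independent repetition. -/

/-- Resampling one coordinate preserves a product measure. -/
theorem measurePreserving_update_infinitePi {ι : Type*} [DecidableEq ι] {X : ι → Type*}
    [∀ i, MeasurableSpace (X i)] (μ : ∀ i, Measure (X i)) [∀ i, IsProbabilityMeasure (μ i)]
    (j : ι) :
    MeasurePreserving (fun p : (∀ i, X i) × X j => Function.update p.1 j p.2)
      ((Measure.infinitePi μ).prod (μ j)) (Measure.infinitePi μ) := by
  have hmeas : Measurable fun p : (∀ i, X i) × X j => Function.update p.1 j p.2 := by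
    refine measurable_pi_lambda _ fun i => ?_
    rcases eq_or_ne i j with rfl | hi
    · simpa using measurable_snd
    · simp only [Function.update_of_ne hi]
      fun_prop
  refine ⟨hmeas, Measure.eq_infinitePi μ fun s t ht => ?_⟩
  rw [Measure.map_apply hmeas (.pi s.countable_toSet fun i _ => ht i)]
  -- On a finite box the new coordinate matters only if `j` is constrained; it then supplies the
  -- factor that the old coordinate `j` loses.
  by_cases hj : j ∈ s
  · have : (fun p : (∀ i, X i) × X j => Function.update p.1 j p.2) ⁻¹' Set.pi s t
        = Set.pi (s.erase j) t ×ˢ t j := by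
      ext p
      simp only [Set.mem_preimage, Set.mem_pi, Set.mem_prod, Finset.mem_coe, Finset.mem_erase]
      constructor
      · intro h
        exact ⟨fun i hi => by simpa [Function.update_of_ne hi.1] using h i hi.2,
          by simpa using h j hj⟩
      · rintro ⟨h1, h2⟩ i hi
        rcases eq_or_ne i j with rfl | hij
        · simpa using h2
        · simpa [Function.update_of_ne hij] using h1 i ⟨hij, hi⟩
    rw [this, Measure.prod_prod, Measure.infinitePi_pi _ fun i _ => ht i,
      Finset.prod_erase_mul _ _ hj]
  · have : (fun p : (∀ i, X i) × X j => Function.update p.1 j p.2) ⁻¹' Set.pi s t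
        = Set.pi s t ×ˢ Set.univ := by
      ext p
      simp only [Set.mem_preimage, Set.mem_pi, Set.mem_prod, Finset.mem_coe, Set.mem_univ,
        and_true]
      refine forall₂_congr fun i hi => ?_
      rw [Function.update_of_ne (by rintro rfl; exact hj hi)]
    rw [this, Measure.prod_prod, Measure.infinitePi_pi _ fun i _ => ht i, measure_univ, mul_one]

section Seeds

variable {Ξ : Type w} [MeasurableSpace Ξ] (ν : Measure Ξ) [IsProbabilityMeasure ν]

instance isProbabilityMeasure_layerLaw : IsProbabilityMeasure (layerLaw ν) := by
  unfold layerLaw; infer_instance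

instance isProbabilityMeasure_seedLaw : IsProbabilityMeasure (seedLaw ν) := by
  unfold seedLaw; infer_instance

/-- The seeds `ω` with the seeds of layer `j.2` of epoch `j.1` replaced by `y`. -/
def reseed (ω : Seeds Ξ) (j : ℕ × ℕ) (y : LayerSeed Ξ) : Seeds Ξ :=
  (ω.1, Function.update ω.2 j y)

theorem measurePreserving_reseed (j : ℕ × ℕ) :
    MeasurePreserving (fun p : Seeds Ξ × LayerSeed Ξ => reseed p.1 j p.2)
      ((seedLaw ν).prod (layerLaw ν)) (seedLaw ν) := by
  have h1 := measurePreserving_prodAssoc (Measure.infinitePi fun _ : ℕ => ν)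
    (Measure.infinitePi fun _ : ℕ × ℕ => layerLaw ν) (layerLaw ν)
  have h2 := (MeasurePreserving.id (Measure.infinitePi fun _ : ℕ => ν)).prod
    (measurePreserving_update_infinitePi (fun _ : ℕ × ℕ => layerLaw ν) j)
  exact h2.comp h1

/-- If an event has conditional probability at most `p` given all seeds but those of one layer of
one epoch, on the event `U` that does not depend on the latter, then its intersection with `U`
has probability at most `p` times that of `U`. -/
theorem seedLaw_inter_le (j : ℕ × ℕ) {B U : Set (Seeds Ξ)} (hB : MeasurableSet B)
    (hU : MeasurableSet U) (hUinv : ∀ ω y, reseed ω j y ∈ U ↔ ω ∈ U) {p : ENNReal}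
    (hp : ∀ ω ∈ U, layerLaw ν {y | reseed ω j y ∈ B} ≤ p) :
    seedLaw ν (U ∩ B) ≤ p * seedLaw ν U := by
  have hmp := measurePreserving_reseed ν j
  rw [← hmp.measure_preimage (hU.inter hB).nullMeasurableSet,
    Measure.prod_apply (hmp.measurable (hU.inter hB)), ← setLIntegral_const,
    ← lintegral_indicator hU]
  refine lintegral_mono fun ω => ?_
  by_cases hω : ω ∈ U
  · rw [Set.indicator_of_mem hω]
    refine (measure_mono ?_).trans (hp ω hω)
    exact fun y hy => hy.2
  · rw [Set.indicator_of_notMem hω, nonpos_iff_eq_zero]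
    convert measure_empty (μ := layerLaw ν)
    ext y
    simp [hUinv, hω]

theorem layerLaw_eval_preimage (r : ℕ) {B : Set Ξ} (hB : MeasurableSet B) :
    layerLaw ν {x | x.1 r ∈ B} = ν B :=
  ((measurePreserving_eval_infinitePi (fun _ : ℕ => ν) r).comp
    measurePreserving_fst).measure_preimage hB.nullMeasurableSet

theorem layerLaw_forall_lt (R : ℕ) {B : Set Ξ} (hB : MeasurableSet B) :
    layerLaw ν {x | ∀ r < R, x.1 r ∈ B} = ν B ^ R := by
  have : {x : LayerSeed Ξ | ∀ r < R, x.1 r ∈ B}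
      = Set.pi (Finset.range R) (fun _ => B) ×ˢ Set.univ := by
    ext x; simp
  rw [this, layerLaw, Measure.prod_prod, Measure.infinitePi_pi _ fun _ _ => hB]
  simp

/-- Markov's inequality at twice the mean. Mean zero is separate, since one cannot divide by it;
then `f` vanishes almost everywhere and the strict inequality makes the event null. -/
theorem measure_two_mul_integral_lt_le {f : Ξ → ℝ} (hf : ∀ ξ, 0 ≤ f ξ) (hfi : Integrable f ν) :
    ν {ξ | 2 * ∫ ξ, f ξ ∂ν < f ξ} ≤ 2⁻¹ := by
  have h0 : 0 ≤ ∫ ξ, f ξ ∂ν := integral_nonneg hf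
  rcases h0.eq_or_lt with h | h
  · have hz : f =ᵐ[ν] 0 := (integral_eq_zero_iff_of_nonneg hf hfi).1 h.symm
    have : ν {ξ | 2 * ∫ ξ, f ξ ∂ν < f ξ} = 0 := by
      rw [← h, mul_zero]
      refine measure_mono_null (fun ξ hξ => ?_) hz
      exact fun h0 => (ne_of_gt hξ) h0
    simp [this]
  · have h1 := mul_meas_ge_le_integral_of_nonneg (ae_of_all ν hf) hfi (2 * ∫ ξ, f ξ ∂ν)
    have h2 : ν.real {ξ | 2 * ∫ ξ, f ξ ∂ν ≤ f ξ} ≤ 2⁻¹ := by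
      rw [← mul_le_mul_iff_of_pos_left (mul_pos two_pos h)]
      linarith
    have h3 : {ξ | 2 * ∫ ξ, f ξ ∂ν < f ξ} ⊆ {ξ | 2 * ∫ ξ, f ξ ∂ν ≤ f ξ} :=
      fun ξ (hξ : 2 * ∫ ξ, f ξ ∂ν < f ξ) => show 2 * ∫ ξ, f ξ ∂ν ≤ f ξ from hξ.le
    refine (measure_mono h3).trans ?_
    rw [← ofReal_measureReal]
    refine (ENNReal.ofReal_le_ofReal h2).trans ?_
    rw [ENNReal.ofReal_inv_of_pos two_pos]
    simp

end Seeds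

/-! ### Failure probability of one layer on fixed inputs. -/

section Framework

variable {m H : ℕ} {S : ℕ → Type u} {A : Fin m → Type v} {Ξ : Type w}
  [∀ h, Fintype (S h)] [∀ i, Fintype (A i)] [MeasurableSpace Ξ]

section Measurability

variable {Ω : Type*} [MeasurableSpace Ω] (G : MarkovGame m H S A) (h : ℕ)
  {V : Ω → S (h + 1) → Fin m → ℝ} {π : Ω → LayerPolicy S A h} {gap Vhat : Ω → S h → Fin m → ℝ}

theorem measurable_prob (hπ : Measurable π) (s : S h) (a : ∀ i, A i) :
    Measurable fun ω => (π ω s).1 a :=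
  (measurable_pi_apply a).comp (measurable_subtype_coe.comp ((measurable_pi_apply s).comp hπ))

theorem MarkovGame.measurable_bellman (hV : Measurable V) (i : Fin m) (s : S h)
    (a : ∀ i, A i) : Measurable fun ω => G.bellman i h (fun s' => V ω s' i) s a := by
  simp only [MarkovGame.bellman, ProbVec.expect]
  fun_prop

theorem MarkovGame.measurable_expect_bellman (hV : Measurable V) (hπ : Measurable π)
    (i : Fin m) (s : S h) :
    Measurable fun ω => (π ω s).expect (G.bellman i h (fun s' => V ω s' i) s) :=
  Finset.measurable_sum _ fun a _ =>
    (measurable_prob h hπ s a).mul (G.measurable_bellman h hV i s a)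

/-- Deviations form a continuum; `gapBound_iff` replaces them by the finitely many pure ones. -/
theorem MarkovGame.measurableSet_gapBound (hV : Measurable V) (hπ : Measurable π)
    (hgap : Measurable gap) : MeasurableSet {ω | G.GapBound h (V ω) (π ω) (gap ω)} := by
  simp only [gapBound_iff, Set.ofPred_forall]
  refine MeasurableSet.iInter fun i => MeasurableSet.iInter fun s =>
    MeasurableSet.iInter fun c => measurableSet_le ?_ (by fun_prop)
  refine (G.measurable_expect_bellman h hV hπ i s).sub (Finset.measurable_sum _ fun a _ => ?_)
  exact ((Finset.measurable_sum _ fun b _ => measurable_prob h hπ s _).const_mul _).mul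
    (G.measurable_bellman h hV i s a)

theorem MarkovGame.measurableSet_optimistic (hV : Measurable V) (hπ : Measurable π)
    (hgap : Measurable gap) (hVhat : Measurable Vhat) :
    MeasurableSet {ω | G.Optimistic h (V ω) (π ω) (gap ω) (Vhat ω)} := by
  simp only [MarkovGame.Optimistic, Set.mem_Icc, Set.ofPred_forall]
  refine MeasurableSet.iInter fun i => MeasurableSet.iInter fun s => ?_
  have h1 := G.measurable_expect_bellman h hV hπ i s
  exact (measurableSet_le (h1.sub (by fun_prop)) (by fun_prop)).inter
    (measurableSet_le (by fun_prop) ((h1.sub (by fun_prop)).max measurable_const))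

end Measurability

namespace Framework

variable {ν : Measure Ξ} [IsProbabilityMeasure ν]

/-- In layer `h` of an update, the selected gap estimates bound the gain of a deviation, the
V-function is optimistic, and the sums of the selected gap estimates are at most twice their
expectations for a single execution. -/
def LayerGood (F : Framework H S A ν) (h n : ℕ) (p : Fin n → Policy S A)
    (V : S (h + 1) → Fin m → ℝ) (K : ℕ) (x : LayerSeed Ξ) : Prop :=
  F.game.GapBound h V (F.layerChoice h n p V K x.1).1 (F.layerChoice h n p V K x.1).2 ∧
  F.game.Optimistic h V (F.layerChoice h n p V K x.1).1 (F.layerChoice h n p V K x.1).2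
    (F.layerValue h n p V K x) ∧
  ∀ s, ∑ i, (F.layerChoice h n p V K x.1).2 s i
    ≤ 2 * ∑ i, ∫ ξ, (F.cce.out h n p V K ξ).2 s i ∂ν

theorem measurableSet_layerGood {Ω : Type*} [MeasurableSpace Ω] (F : Framework H S A ν)
    (h n K : ℕ) {p : Ω → Fin n → Policy S A} {V : Ω → S (h + 1) → Fin m → ℝ}
    {x : Ω → LayerSeed Ξ} (hp : Measurable p) (hV : Measurable V) (hx : Measurable x) :
    MeasurableSet {ω | F.LayerGood h n (p ω) (V ω) K (x ω)} := by
  have hc := F.measurable_layerChoice h n K hp hV hx.fst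
  refine (F.game.measurableSet_gapBound h hV hc.fst hc.snd).inter
    ((F.game.measurableSet_optimistic h hV hc.fst hc.snd
      (F.measurable_layerValue h n K hp hV hx)).inter ?_)
  have hint : ∀ s i, Measurable fun ω => ∫ ξ, (F.cce.out h n (p ω) (V ω) K ξ).2 s i ∂ν := by
    intro s i
    have ho : Measurable fun y : Ω × Ξ => F.cce.out h n (p y.1) (V y.1) K y.2 :=
      (F.cce.measurable_out h n K).comp ((hp.comp measurable_fst).prodMk
        ((hV.comp measurable_fst).prodMk measurable_snd))
    have ho' : Measurable fun y : Ω × Ξ => (F.cce.out h n (p y.1) (V y.1) K y.2).2 s i := by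
      fun_prop
    exact ho'.stronglyMeasurable.integral_prod_right'.measurable
  change MeasurableSet {ω | ∀ s, _ ≤ _}
  simp only [Set.ofPred_forall]
  refine MeasurableSet.iInter fun s => measurableSet_le (Finset.measurable_sum _ fun i _ => ?_)
    ((Finset.measurable_sum _ fun i _ => hint s i).const_mul 2)
  exact (measurable_pi_apply i).comp ((measurable_pi_apply s).comp hc.snd)

/-- A layer of an update is good with high probability. -/
theorem layerLaw_not_layerGood_le (F : Framework H S A ν) {δ : ℝ} (hR : 0 < F.R)
    (hreg : F.GapRegular) (hnr : F.PerStateNoRegret δ) (hopt : F.OptimisticV δ) {h n K : ℕ}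
    (hh : h < H) (hn : 1 ≤ n) (hK : 1 ≤ K) (p : Fin n → Policy S A)
    (V : S (h + 1) → Fin m → ℝ) :
    layerLaw ν {x | ¬ F.LayerGood h n p V K x}
      ≤ F.R * ENNReal.ofReal δ + ENNReal.ofReal δ + Fintype.card (S h) * 2⁻¹ ^ F.R := by
  have hout : Measurable fun ξ => F.cce.out h n p V K ξ :=
    (F.cce.measurable_out h n K).comp
      (measurable_const.prodMk (measurable_const.prodMk measurable_id))
  -- The selected index varies with the state and the seeds, so all `R` executions are required to
  -- satisfy the gap bound; hence the factor `R`.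
  let E₁ : ℕ → Set (LayerSeed Ξ) := fun r => {x | x.1 r ∈
    {ξ | ¬ F.game.GapBound h V (F.cce.out h n p V K ξ).1 (F.cce.out h n p V K ξ).2}}
  let E₂ : Set (LayerSeed Ξ) := {x | ¬ F.game.Optimistic h V (F.layerChoice h n p V K x.1).1
        (F.layerChoice h n p V K x.1).2 (F.layerValue h n p V K x)}
  let f : S h → Ξ → ℝ := fun s ξ => ∑ i, (F.cce.out h n p V K ξ).2 s i
  -- Selection fails at `s` only if every execution exceeds twice the mean of the sum over agents.
  let E₃ : S h → Set (LayerSeed Ξ) := fun s =>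
    {x | ∀ r < F.R, x.1 r ∈ {ξ | 2 * ∫ ξ, f s ξ ∂ν < f s ξ}}
  have hsub : {x | ¬ F.LayerGood h n p V K x}
      ⊆ ((⋃ r ∈ Finset.range F.R, E₁ r) ∪ E₂) ∪ ⋃ s ∈ Finset.univ, E₃ s := by
    intro x hx
    by_contra hcon
    simp only [Set.mem_union, Set.mem_iUnion, not_or, not_exists, Finset.mem_range] at hcon
    obtain ⟨⟨h1, h2⟩, h3⟩ := hcon
    refine hx ⟨fun i s q => ?_, not_not.1 h2, fun s => ?_⟩
    -- The gap bound is a condition at each state separately, so it survives patching different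
    -- executions together.
    · exact not_not.1 (h1 _ (argminBelow_lt _ hR)) i s q
    · have h3 := h3 s (Finset.mem_univ s)
      simp only [E₃, Set.mem_ofPred_eq, not_forall, not_lt] at h3
      obtain ⟨r, hr, h3⟩ := h3
      rw [← integral_finsetSum _ fun i _ => (hreg h n K p V s i hh hn hK).2]
      exact (argminBelow_le (fun r => ∑ i, (F.cce.out h n p V K (x.1 r)).2 s i) hr).trans h3
  refine (measure_mono hsub).trans ((measure_union_le _ _).trans (add_le_add
    ((measure_union_le _ _).trans (add_le_add ?_ (hopt h n K p V hh hn hK))) ?_))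
  · refine (measure_biUnion_finset_le _ _).trans ?_
    have : ∀ r ∈ Finset.range F.R, layerLaw ν (E₁ r) ≤ ENNReal.ofReal δ := fun r _ => by
      exact (layerLaw_eval_preimage ν r (F.game.measurableSet_gapBound h
        (V := fun _ => V) measurable_const hout.fst hout.snd).compl).trans_le
        (hnr h n K p V hh hn hK)
    simpa using Finset.sum_le_sum this
  · refine (measure_biUnion_finset_le _ _).trans ?_
    have : ∀ s ∈ Finset.univ, layerLaw ν (E₃ s) ≤ 2⁻¹ ^ F.R := fun s _ => by
      have hf : Measurable (f s) := Finset.measurable_sum _ fun i _ => by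
        have := hout.snd
        fun_prop
      rw [layerLaw_forall_lt ν F.R (measurableSet_lt measurable_const hf)]
      gcongr
      exact measure_two_mul_integral_lt_le ν
        (fun ξ => Finset.sum_nonneg fun i _ => (hreg h n K p V s i hh hn hK).1 ξ)
        (integrable_finsetSum _ fun i _ => (hreg h n K p V s i hh hn hK).2)
    simpa using Finset.sum_le_sum this

end Framework
end Framework

/-! ### Union bound over the updates, and the regret. -/

section Framework

variable {m H : ℕ} {S : ℕ → Type u} {A : Fin m → Type v} {Ξ : Type w}
  [∀ h, Fintype (S h)] [∀ i, Fintype (A i)] [MeasurableSpace Ξ]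

namespace Framework

variable {ν : Measure Ξ} [IsProbabilityMeasure ν] [∀ i, Nonempty (A i)]

/-- The layer `h` is good in the update of epoch `t`. -/
def UpdateGood (F : Framework H S A ν) (ω : Seeds Ξ) (t h : ℕ) : Prop :=
  F.LayerGood h t (fun k => F.policy ω k) (F.epochV ω t (h + 1)) t (ω.2 (t, h))

theorem measurableSet_updateGood (F : Framework H S A ν) (t h : ℕ) :
    MeasurableSet {ω | F.UpdateGood ω t h} :=
  F.measurableSet_layerGood h t t (measurable_pi_lambda _ fun k => F.measurable_policy k)
    (F.measurable_epochV t (h + 1)) ((measurable_pi_apply _).comp measurable_snd)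

theorem reseed_of_ne {ω : Seeds Ξ} {j k : ℕ × ℕ} (y : LayerSeed Ξ) (hk : k ≠ j) :
    (reseed ω j y).2 k = ω.2 k :=
  Function.update_of_ne hk _ _

theorem policy_reseed (F : Framework H S A ν) (ω : Seeds Ξ) {t k : ℕ} (hk : k < t) (h : ℕ)
    (y : LayerSeed Ξ) : F.policy (reseed ω (t, h) y) k = F.policy ω k :=
  F.policy_congr (ω := reseed ω (t, h) y) (ω' := ω) rfl k fun j hj h' => reseed_of_ne y (by simp; omega)

theorem lastUpdate_reseed (F : Framework H S A ν) (ω : Seeds Ξ) {t : ℕ} (ht : 1 ≤ t) (h : ℕ)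
    (y : LayerSeed Ξ) : F.lastUpdate (reseed ω (t, h) y) t = t ↔ F.lastUpdate ω t = t := by
  obtain ⟨t, rfl⟩ : ∃ s, t = s + 1 := ⟨t - 1, by omega⟩
  have h2 : ∀ k ≤ t, ∀ h', (reseed ω (t + 1, h) y).2 (k, h') = ω.2 (k, h') :=
    fun k hk h' => reseed_of_ne y (by simp; omega)
  rw [lastUpdate_succ_eq_iff, lastUpdate_succ_eq_iff]
  exact F.updatesAfter_congr (ω := reseed ω (t + 1, h) y) (ω' := ω) rfl h2
    (F.state_congr (ω := reseed ω (t + 1, h) y) (ω' := ω) rfl t h2)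

theorem epochV_reseed (F : Framework H S A ν) (ω : Seeds Ξ) (t h : ℕ) (y : LayerSeed Ξ) :
    F.epochV (reseed ω (t, h) y) t (h + 1) = F.epochV ω t (h + 1) := by
  have hp : (fun k : Fin t => F.policy (reseed ω (t, h) y) k) = fun k : Fin t => F.policy ω k :=
    funext fun k => F.policy_reseed ω k.2 h y
  rw [epochV, hp]
  exact F.vbar_congr _ _ _ _ fun k hk => reseed_of_ne y (by simp; omega)

/-- With the other seeds held fixed, the inputs are constants and only the fresh seed `y` varies, so
the fixed-input bound applies. -/
theorem updateGood_reseed_iff (F : Framework H S A ν) (ω : Seeds Ξ) (t h : ℕ)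
    (y : LayerSeed Ξ) : F.UpdateGood (reseed ω (t, h) y) t h
      ↔ F.LayerGood h t (fun k => F.policy ω k) (F.epochV ω t (h + 1)) t y := by
  have hp : (fun k : Fin t => F.policy (reseed ω (t, h) y) k) = fun k : Fin t => F.policy ω k :=
    funext fun k => F.policy_reseed ω k.2 h y
  rw [UpdateGood, hp, epochV_reseed]
  simp [reseed]

/-- The left side is the expected number of updates. -/
theorem sum_seedLaw_lastUpdate_le (F : Framework H S A ν) {T : ℕ} {d : ℝ}
    (hfew : F.FewUpdates T d) :
    ∑ t ∈ Finset.Icc 1 T, seedLaw ν {ω | F.lastUpdate ω t = t}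
      ≤ ENNReal.ofReal (d * Real.log T) := by
  classical
  calc _ = ∑ t ∈ Finset.Icc 1 T,
        ∫⁻ ω, Set.indicator {ω | F.lastUpdate ω t = t} 1 ω ∂seedLaw ν :=
        Finset.sum_congr rfl fun t _ =>
          (lintegral_indicator_one (F.measurableSet_lastUpdate_eq t)).symm
    _ = ∫⁻ ω, ∑ t ∈ Finset.Icc 1 T, Set.indicator {ω | F.lastUpdate ω t = t} 1 ω ∂seedLaw ν :=
        (lintegral_finsetSum _ fun t _ =>
          measurable_one.indicator (F.measurableSet_lastUpdate_eq t)).symm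
    _ ≤ ∫⁻ _, ENNReal.ofReal (d * Real.log T) ∂seedLaw ν := by
        refine lintegral_mono_ae ?_
        filter_upwards [hfew] with ω hω
        have : ∑ t ∈ Finset.Icc 1 T, Set.indicator {ω | F.lastUpdate ω t = t} 1 ω
            = ((F.updates ω T).card : ENNReal) := by
          simp [updates, Set.indicator_apply]
        rw [this, ← ENNReal.ofReal_natCast]
        exact ENNReal.ofReal_le_ofReal hω
    _ = _ := by simp

/-- Epoch 1 always counts. The bound lets later additive terms be absorbed into multiples of `d *
log T`. -/
theorem one_le_updates_bound (F : Framework H S A ν) {T : ℕ} {d : ℝ} (hT : 1 ≤ T)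
    (hfew : F.FewUpdates T d) : 1 ≤ d * Real.log T := by
  obtain ⟨ω, hω⟩ := hfew.exists
  refine le_trans ?_ hω
  have : 1 ∈ F.updates ω T := by simp [updates, hT, lastUpdate_one]
  exact_mod_cast Finset.card_pos.2 ⟨1, this⟩

/-- The logarithm is tuned so that the selection failures over all states of all layers cost a
single δ per update. It is positive because there is at least one state and δ < 1. -/
theorem numRuns_spec [Nonempty (S 0)] (hH : 1 ≤ H) {δ : ℝ} (hδ : 0 < δ) (hδ1 : δ < 1) :
    0 < numRuns H S δ ∧
      (∑ h ∈ Finset.range H, Fintype.card (S h) : ℕ) * (2⁻¹ : ℝ) ^ numRuns H S δ ≤ δ := by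
  set N := ∑ h ∈ Finset.range H, Fintype.card (S h) with hN
  have hN1 : 1 ≤ N := (Nat.one_le_iff_ne_zero.2 Fintype.card_ne_zero).trans
    (Finset.single_le_sum (f := fun h => Fintype.card (S h)) (fun _ _ => Nat.zero_le _)
      (Finset.mem_range.2 hH))
  have hN1' : (1 : ℝ) ≤ N := by exact_mod_cast hN1
  have h1 : 1 < (N : ℝ) / δ := by rw [lt_div_iff₀ hδ]; linarith
  refine ⟨Nat.ceil_pos.2 (Real.logb_pos one_lt_two h1), ?_⟩
  have h2 : (N : ℝ) / δ ≤ 2 ^ numRuns H S δ := by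
    have h3 := Nat.le_ceil (Real.logb 2 ((N : ℝ) / δ))
    rw [Real.logb_le_iff_le_rpow one_lt_two (by linarith), Real.rpow_natCast] at h3
    exact h3
  rw [inv_pow, ← div_eq_mul_inv, div_le_iff₀ (by positivity)]
  rwa [div_le_iff₀ hδ, mul_comm] at h2

/-- With high probability, all layers of all updates are good. -/
theorem seedLaw_not_updateGood_le (F : Framework H S A ν) {T : ℕ} {δ d : ℝ} (hH : 1 ≤ H)
    (hT : 1 ≤ T) (hδ : 0 < δ) (hδ1 : δ < 1) (hR : F.R = numRuns H S δ) (hreg : F.GapRegular)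
    (hnr : F.PerStateNoRegret δ) (hopt : F.OptimisticV δ) (hfew : F.FewUpdates T d) :
    seedLaw ν {ω | ¬ ∀ t ∈ F.updates ω T, ∀ h < H, F.UpdateGood ω t h}
      ≤ ENNReal.ofReal (3 * (H * (d * Real.log T) * F.R) * δ) := by
  have : Nonempty (S 0) := ⟨F.game.init⟩
  obtain ⟨hR0, hcard⟩ := numRuns_spec (S := S) hH hδ hδ1
  rw [← hR] at hR0 hcard
  let p : ℕ → ENNReal := fun h =>
    F.R * ENNReal.ofReal δ + ENNReal.ofReal δ + Fintype.card (S h) * 2⁻¹ ^ F.R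
  have hsub : {ω | ¬ ∀ t ∈ F.updates ω T, ∀ h < H, F.UpdateGood ω t h}
      ⊆ ⋃ t ∈ Finset.Icc 1 T, ⋃ h ∈ Finset.range H,
        {ω | F.lastUpdate ω t = t} ∩ {ω | ¬ F.UpdateGood ω t h} := by
    intro ω hω
    simp only [Set.mem_ofPred_eq, not_forall, updates, Finset.mem_filter] at hω
    obtain ⟨t, ⟨ht, hl⟩, h, hh, hbad⟩ := hω
    simp only [Set.mem_iUnion]
    exact ⟨t, ht, h, Finset.mem_range.2 hh, hl, hbad⟩
  have hone : ∀ t ∈ Finset.Icc 1 T, ∀ h ∈ Finset.range H,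
      seedLaw ν ({ω | F.lastUpdate ω t = t} ∩ {ω | ¬ F.UpdateGood ω t h})
        ≤ p h * seedLaw ν {ω | F.lastUpdate ω t = t} := by
    intro t ht h hh
    have ht1 := (Finset.mem_Icc.1 ht).1
    refine seedLaw_inter_le ν (t, h) (F.measurableSet_updateGood t h).compl
      (F.measurableSet_lastUpdate_eq t) (fun ω y => F.lastUpdate_reseed ω ht1 h y) fun ω _ => ?_
    change layerLaw ν {y | ¬ F.UpdateGood (reseed ω (t, h) y) t h} ≤ p h
    simp only [updateGood_reseed_iff]
    exact F.layerLaw_not_layerGood_le hR0 hreg hnr hopt (Finset.mem_range.1 hh) ht1 ht1 _ _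
  have hd := F.one_le_updates_bound hT hfew
  have hR1 : (1 : ℝ) ≤ F.R := by exact_mod_cast hR0
  have hH1 : (1 : ℝ) ≤ H := by exact_mod_cast hH
  have hp : ∑ h ∈ Finset.range H, p h ≤ ENNReal.ofReal (3 * (H * F.R) * δ) := by
    have hpe : ∀ h, p h = ENNReal.ofReal
        (F.R * δ + δ + Fintype.card (S h) * (2⁻¹ : ℝ) ^ F.R) := fun h => by
      rw [ENNReal.ofReal_add (by positivity) (by positivity),
        ENNReal.ofReal_add (by positivity) (by positivity),
        ENNReal.ofReal_mul (by positivity), ENNReal.ofReal_mul (by positivity),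
        ENNReal.ofReal_pow (by positivity), ENNReal.ofReal_inv_of_pos two_pos]
      simp [p]
    simp only [hpe]
    rw [← ENNReal.ofReal_sum_of_nonneg fun h _ => by positivity]
    refine ENNReal.ofReal_le_ofReal ?_
    rw [Finset.sum_add_distrib, ← Finset.sum_mul, ← Nat.cast_sum]
    simp only [Finset.sum_const, Finset.card_range, nsmul_eq_mul]
    have h1 : (1 : ℝ) ≤ H * F.R := one_le_mul_of_one_le_of_one_le hH1 hR1
    have h2 : (H : ℝ) ≤ H * F.R := le_mul_of_one_le_right (by positivity) hR1
    -- The three kinds of failure cost `H * R * δ`, `H * δ` and δ, each at most `H * R * δ`.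
    nlinarith
  calc _ ≤ ∑ t ∈ Finset.Icc 1 T, ∑ h ∈ Finset.range H,
          p h * seedLaw ν {ω | F.lastUpdate ω t = t} :=
        (measure_mono hsub).trans <| (measure_biUnion_finset_le _ _).trans <|
          Finset.sum_le_sum fun t ht => (measure_biUnion_finset_le _ _).trans <|
            Finset.sum_le_sum fun h hh => hone t ht h hh
    _ = (∑ h ∈ Finset.range H, p h)
          * ∑ t ∈ Finset.Icc 1 T, seedLaw ν {ω | F.lastUpdate ω t = t} := by
        simp only [← Finset.sum_mul, ← Finset.mul_sum]
    _ ≤ ENNReal.ofReal (3 * (H * F.R) * δ) * ENNReal.ofReal (d * Real.log T) :=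
        mul_le_mul' hp (F.sum_seedLaw_lastUpdate_le hfew)
    _ = _ := by
        rw [← ENNReal.ofReal_mul (by positivity)]
        congr 1
        ring

/-- If the updates are good, the best-response gains of an epoch are bounded by nonnegative numbers
whose sum is controlled by the expected gap estimates. -/
theorem exists_gain_bound (F : Framework H S A ν) (hreg : F.GapRegular) {ω : Seeds Ξ} {T : ℕ}
    (hgood : ∀ t ∈ F.updates ω T, ∀ h < H, F.UpdateGood ω t h) {t : ℕ}
    (ht : t ∈ Finset.Icc 1 T) :
    ∃ b : Fin m → ℝ, (∀ i, 0 ≤ b i) ∧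
      (∀ i, F.game.value (F.policy ω t) i 0 F.game.init
        - F.game.bestResponse (F.policy ω t) i 0 F.game.init ≤ b i) ∧
      ∑ i, b i ≤ ∑ h ∈ Finset.range H, 4 * ∑ i : Fin m, ∑ s : S h,
        F.game.visit (F.policy ω t) h s * F.meanGap ω t h s i := by
  obtain ⟨ht1, htT⟩ := Finset.mem_Icc.1 ht
  obtain ⟨hl1, hll, hpol⟩ := F.lastUpdate_spec ω ht1
  simp only [meanGap_eq]
  have hlT := (F.lastUpdate_le ω t).trans htT
  rw [hpol]
  generalize F.lastUpdate ω t = τ at *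
  have hgood := hgood τ (by simp [updates, hl1, hlT, hll])
  have hpτ := F.policy_of_update hl1 hll
  let c : ∀ h, LayerPolicy S A h × (S h → Fin m → ℝ) := fun h =>
    F.layerChoice h τ (fun k => F.policy ω k) (F.epochV ω τ (h + 1)) τ (ω.2 (τ, h)).1
  have hc : ∀ h, F.policy ω τ h = (c h).1 := fun h => congrFun hpτ h
  have hV : ∀ h < H, F.epochV ω τ h = F.layerValue h τ (fun k => F.policy ω k)
      (F.epochV ω τ (h + 1)) τ (ω.2 (τ, h)) := fun h hh => F.vbar_step _ _ _ _ hh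
  have hnonneg : ∀ h < H, ∀ s i, 0 ≤ (c h).2 s i := fun h hh s i =>
    (hreg h τ τ _ _ s i hh hl1 hl1).1 _
  -- The factor 4 below is 2 from the telescoping times 2 from the selection; the latter holds only
  -- after summing over agents.
  refine ⟨fun i => ∑ h ∈ Finset.range H, ∑ s, F.game.visit (F.policy ω τ) h s
    * (2 * (c h).2 s i), fun i => ?_, fun i => ?_, ?_⟩
  · exact Finset.sum_nonneg fun h hh => Finset.sum_nonneg fun s _ =>
      mul_nonneg (F.game.visit_nonneg _ _ _)
        (mul_nonneg two_pos.le (hnonneg h (Finset.mem_range.1 hh) s i))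
  · refine F.game.value_sub_bestResponse_le (V := F.epochV ω τ) (gap := fun h => (c h).2)
      (F.vbar_terminal _ _ _ _) (fun h hh => ?_) (fun h hh => ?_) i
    · rw [hc]
      exact (hgood h hh).1
    · rw [hc, hV h hh]
      exact (hgood h hh).2.1
  · rw [Finset.sum_comm]
    refine Finset.sum_le_sum fun h hh => ?_
    rw [Finset.sum_comm, Finset.sum_comm (s := (Finset.univ : Finset (Fin m))), Finset.mul_sum]
    refine Finset.sum_le_sum fun s _ => ?_
    rw [← Finset.mul_sum, ← Finset.mul_sum, ← Finset.mul_sum]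
    have := (hgood h (Finset.mem_range.1 hh)).2.2 s
    change ∑ i, (c h).2 s i ≤ 2 * ∑ i, F.updateMeanGap ω τ h s i at this
    have := mul_le_mul_of_nonneg_left this (F.game.visit_nonneg (F.policy ω τ) h s)
    linarith

/-- With high probability, the summed regret and the regret of each agent are bounded. -/
theorem seedLaw_not_regret_le (F : Framework H S A ν) {T : ℕ} {δ L d : ℝ} (hH : 1 ≤ H)
    (hT : 1 ≤ T) (hδ : 0 < δ) (hδ1 : δ < 1) (hR : F.R = numRuns H S δ)
    (hreg : F.GapRegular) (hnr : F.PerStateNoRegret δ) (hopt : F.OptimisticV δ)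
    (hfew : F.FewUpdates T d) (hpig : F.PigeonHole T δ L) :
    seedLaw ν {ω | ¬ (F.regret ω T ≤ 4 * (m * H * √(L * T)) * Real.log (T / δ) ∧
      ∀ i, ∑ t ∈ Finset.Icc 1 T, (F.game.value (F.policy ω t) i 0 F.game.init
        - F.game.bestResponse (F.policy ω t) i 0 F.game.init)
          ≤ 4 * (m * H * √(L * T)) * Real.log (T / δ))}
      ≤ ENNReal.ofReal (4 * (H * (d * Real.log T) * F.R) * δ) := by
  have : Nonempty (S 0) := ⟨F.game.init⟩
  have hT1 : (1 : ℝ) ≤ T := by exact_mod_cast hT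
  have hlog : 0 ≤ Real.log (T / δ) :=
    Real.log_nonneg (by rw [le_div_iff₀ hδ]; linarith)
  have hdet : {ω | ¬ (F.regret ω T ≤ 4 * (m * H * √(L * T)) * Real.log (T / δ) ∧
      ∀ i, ∑ t ∈ Finset.Icc 1 T, (F.game.value (F.policy ω t) i 0 F.game.init
        - F.game.bestResponse (F.policy ω t) i 0 F.game.init)
          ≤ 4 * (m * H * √(L * T)) * Real.log (T / δ))}
      ⊆ {ω | ¬ ∀ t ∈ F.updates ω T, ∀ h < H, F.UpdateGood ω t h} ∪
        {ω | ¬ ∀ h < H, ∑ t ∈ Finset.Icc 1 T, ∑ i : Fin m, ∑ s : S h,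
          F.game.visit (F.policy ω t) h s * F.meanGap ω t h s i
            ≤ m * √(L * T * Real.log (T / δ) ^ 2)} := by
    intro ω hω
    by_contra hcon
    simp only [Set.mem_union, Set.mem_ofPred_eq, not_or, not_not] at hcon
    obtain ⟨hgood, hph⟩ := hcon
    refine hω ?_
    choose! b hb0 hb hbsum using fun t (ht : t ∈ Finset.Icc 1 T) =>
      F.exists_gain_bound hreg hgood ht
    have htotal : ∑ t ∈ Finset.Icc 1 T, ∑ i, b t i
        ≤ 4 * (m * H * √(L * T)) * Real.log (T / δ) := by
      calc _ ≤ ∑ t ∈ Finset.Icc 1 T, ∑ h ∈ Finset.range H, 4 * ∑ i : Fin m, ∑ s : S h,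
            F.game.visit (F.policy ω t) h s * F.meanGap ω t h s i := Finset.sum_le_sum hbsum
        _ = ∑ h ∈ Finset.range H, 4 * ∑ t ∈ Finset.Icc 1 T, ∑ i : Fin m, ∑ s : S h,
            F.game.visit (F.policy ω t) h s * F.meanGap ω t h s i := by
          rw [Finset.sum_comm]
          exact Finset.sum_congr rfl fun h _ => (Finset.mul_sum _ _ _).symm
        _ ≤ ∑ h ∈ Finset.range H, 4 * (m * √(L * T * Real.log (T / δ) ^ 2)) :=
          Finset.sum_le_sum fun h hh =>
            mul_le_mul_of_nonneg_left (hph h (Finset.mem_range.1 hh)) (by norm_num)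
        _ = _ := by
          rw [Real.sqrt_mul' _ (sq_nonneg _), Real.sqrt_sq hlog]
          simp
          ring
    constructor
    · refine le_trans ?_ htotal
      rw [regret, Finset.sum_comm]
      exact Finset.sum_le_sum fun t ht => Finset.sum_le_sum fun i _ => hb t ht i
    · intro i
      refine le_trans ?_ htotal
      -- Under a correlated policy a best-response gain can be negative, so one agent's regret is
      -- not bounded by the total. The majorants `b` are nonnegative and allow this comparison.
      exact Finset.sum_le_sum fun t ht => (hb t ht i).trans
        (Finset.single_le_sum (fun i _ => hb0 t ht i) (Finset.mem_univ i))
  refine (measure_mono hdet).trans ((measure_union_le _ _).trans ((add_le_add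
    (F.seedLaw_not_updateGood_le hH hT hδ hδ1 hR hreg hnr hopt hfew) hpig).trans ?_))
  have hd := F.one_le_updates_bound hT hfew
  have hR1 : (1 : ℝ) ≤ F.R := by
    rw [hR]; exact_mod_cast (numRuns_spec (S := S) hH hδ hδ1).1
  have hH1 : (1 : ℝ) ≤ H := by exact_mod_cast hH
  have h1 : 1 ≤ H * (d * Real.log T) * F.R :=
    one_le_mul_of_one_le_of_one_le (one_le_mul_of_one_le_of_one_le hH1 hd) hR1
  rw [← ENNReal.ofReal_add (by positivity) hδ.le]
  refine ENNReal.ofReal_le_ofReal ?_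
  nlinarith

end Framework
end Framework

/-! ### Calibration of the number of epochs. -/

section Numerics

variable {X δ : ℝ} {T : ℕ}

theorem half_lt_log_ratio (hX : 1 ≤ X) (hδ : 0 < δ) (hδ1 : δ < 1) :
    1 / 2 < Real.log (2 * X / δ) := by
  have h2 : (2 : ℝ) ≤ 2 * X / δ := by rw [le_div_iff₀ hδ]; nlinarith
  have := Real.log_two_gt_d9
  have := Real.log_le_log two_pos h2
  linarith

theorem epochs_le (hX : 1 ≤ X) (hδ : 0 < δ) (hδ1 : δ < 1)
    (hT : T = ⌈65536 * X * Real.log (2 * X / δ) ^ 2⌉₊) :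
    (T : ℝ) ≤ 131072 * (X * Real.log (2 * X / δ) ^ 2) := by
  have hl := half_lt_log_ratio hX hδ hδ1
  have h1 : (T : ℝ) < 65536 * X * Real.log (2 * X / δ) ^ 2 + 1 := by
    rw [hT]; exact Nat.ceil_lt_add_one (by positivity)
  -- Bounded away from 0, so doubling the constant absorbs the 1 lost to the ceiling.
  have h2 : 1 / 4 ≤ X * Real.log (2 * X / δ) ^ 2 := by nlinarith
  linarith

theorem log_epochs_le (hX : 1 ≤ X) (hδ : 0 < δ) (hδ1 : δ < 1) (hT1 : 1 ≤ T)
    (hT : T = ⌈65536 * X * Real.log (2 * X / δ) ^ 2⌉₊) :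
    Real.log (T / δ) ≤ 19 * Real.log (2 * X / δ) := by
  have hl := half_lt_log_ratio hX hδ hδ1
  have hTle := epochs_le hX hδ hδ1 hT
  set y := 2 * X / δ with hy
  have hy2 : (2 : ℝ) ≤ y := by rw [hy, le_div_iff₀ hδ]; nlinarith
  have hly : Real.log y ≤ y := (Real.log_le_sub_one_of_pos (by linarith)).trans (by linarith)
  -- Since `y ≥ 2`, the constant 2^16 is at most `y ^ 16`; the remaining `y * log² y` contributes
  -- three more powers.
  have h1 : (T : ℝ) / δ ≤ y ^ 19 := by
    calc (T : ℝ) / δ ≤ 131072 * (X * Real.log y ^ 2) / δ := by gcongr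
      _ = 65536 * (y * Real.log y ^ 2) := by rw [hy]; ring
      _ ≤ 2 ^ 16 * (y * y ^ 2) := by
        have : Real.log y ^ 2 ≤ y ^ 2 := by gcongr
        norm_num
        gcongr
      _ ≤ y ^ 16 * (y * y ^ 2) := by gcongr
      _ = y ^ 19 := by ring
  have hTpos : (0 : ℝ) < T := by exact_mod_cast hT1
  calc Real.log (T / δ) ≤ Real.log (y ^ 19) := Real.log_le_log (by positivity) h1
    _ = 19 * Real.log y := by rw [Real.log_pow]; norm_num

/-- The number of epochs suffices for an average regret of at most `ε`. -/
theorem regret_bound_le {m H : ℕ} {L ε : ℝ} (hm : 1 ≤ m) (hH : 1 ≤ H) (hL : 1 ≤ L) (hε : 0 < ε)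
    (hεH : ε ≤ H) (hδ : 0 < δ) (hδ1 : δ < 1) (hT1 : 1 ≤ T)
    (hX : X = m ^ 2 * H ^ 2 * L / ε ^ 2)
    (hT : T = ⌈65536 * X * Real.log (2 * X / δ) ^ 2⌉₊) :
    1 ≤ X ∧ H + 4 * (m * H * √(L * T)) * Real.log (T / δ) ≤ ε * T := by
  have hm1 : (1 : ℝ) ≤ m := by exact_mod_cast hm
  have hH1 : (1 : ℝ) ≤ H := by exact_mod_cast hH
  have hTpos : (0 : ℝ) < T := by exact_mod_cast hT1
  have hmL : (1 : ℝ) ≤ m ^ 2 * L := one_le_mul_of_one_le_of_one_le (one_le_pow₀ hm1) hL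
  have hXε : ε ^ 2 * X = m ^ 2 * H ^ 2 * L := by rw [hX]; field_simp
  have hHX : (H : ℝ) ^ 2 ≤ ε ^ 2 * X := by
    rw [hXε]
    nlinarith [sq_nonneg (H : ℝ)]
  have hX1 : 1 ≤ X := by
    have : ε ^ 2 ≤ ε ^ 2 * X := le_trans (by gcongr) hHX
    exact le_of_mul_le_mul_left (by linarith) (pow_pos hε 2)
  have hl := half_lt_log_ratio hX1 hδ hδ1
  have hlT := log_epochs_le hX1 hδ hδ1 hT1 hT
  have hTge : 65536 * X * Real.log (2 * X / δ) ^ 2 ≤ T := by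
    conv_rhs => rw [hT]
    exact Nat.le_ceil _
  refine ⟨hX1, ?_⟩
  generalize Real.log (2 * X / δ) = l at *
  have h1 : (H : ℝ) ≤ ε * X := by
    have : H * ε ≤ (ε * X) * ε := by nlinarith
    exact le_of_mul_le_mul_right this hε
  -- Half of the budget `ε * T` goes to the uniform policy of index 0, the other half to the regret.
  have h2 : (H : ℝ) ≤ ε * T / 2 := by
    have hl2 : 1 / 4 ≤ l ^ 2 := by nlinarith
    have := mul_le_mul_of_nonneg_left hl2 (by linarith : 0 ≤ X)
    have : 2 * X ≤ T := by linarith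
    nlinarith
  have h3 : (m : ℝ) * H * √(L * T) = ε * √(X * T) := by
    have : (m : ℝ) ^ 2 * H ^ 2 * L * T = ε ^ 2 * X * T := by rw [hXε]
    have h4 : (m : ℝ) * H * √(L * T) = √((m * H) ^ 2 * (L * T)) := by
      rw [Real.sqrt_mul (sq_nonneg _), Real.sqrt_sq (by positivity)]
    have h5 : ε * √(X * T) = √(ε ^ 2 * (X * T)) := by
      rw [Real.sqrt_mul (sq_nonneg _), Real.sqrt_sq hε.le]
    rw [h4, h5]
    congr 1
    linarith
  -- Here 65536 = 256². The regret then needs 4 · 19 = 76 ≤ 256 / 2.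
  have h4 : 256 * l * √(X * T) ≤ T := by
    have : 256 * l * √(X * T) = √((256 * l) ^ 2 * (X * T)) := by
      rw [Real.sqrt_mul (sq_nonneg _), Real.sqrt_sq (by linarith)]
    rw [this, Real.sqrt_le_left hTpos.le]
    nlinarith
  have h5 : 4 * (m * H * √(L * T)) * Real.log (T / δ) ≤ ε * T / 2 := by
    rw [h3]
    calc 4 * (ε * √(X * T)) * Real.log (T / δ) ≤ 4 * (ε * √(X * T)) * (19 * l) := by gcongr
      _ = ε * (76 * (l * √(X * T))) := by ring
      _ ≤ ε * (T / 2) := by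
        have : 0 ≤ l * √(X * T) := mul_nonneg (by linarith) (Real.sqrt_nonneg _)
        gcongr
        linarith
      _ = _ := by ring
  linarith

end Numerics

/-! ### From regret to the output policy; counting samples. -/

section Framework

variable {m H : ℕ} {S : ℕ → Type u} {A : Fin m → Type v} {Ξ : Type w}
  [∀ h, Fintype (S h)] [∀ i, Fintype (A i)] [MeasurableSpace Ξ]

namespace Framework

variable {ν : Measure Ξ} [∀ i, Nonempty (A i)]

theorem isInformedCCE_output (F : Framework H S A ν) {ω : Seeds Ξ} {T : ℕ} {ε B : ℝ}
    (hB : ∀ i, ∑ t ∈ Finset.Icc 1 T, (F.game.value (F.policy ω t) i 0 F.game.init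
        - F.game.bestResponse (F.policy ω t) i 0 F.game.init) ≤ B)
    (hε : 0 ≤ ε) (hBε : H + B ≤ ε * T) : F.game.IsInformedCCE (F.output ω T) ε := by
  intro i
  let f : ℕ → ℝ := fun t => F.game.value (F.policy ω t) i 0 F.game.init
        - F.game.bestResponse (F.policy ω t) i 0 F.game.init
  have h1 : ∑ k : Fin (T + 1), f k = f 0 + ∑ t ∈ Finset.Icc 1 T, f t := by
    rw [Fin.sum_univ_eq_sum_range f (T + 1), Finset.range_eq_Ico,
      Finset.sum_eq_sum_Ico_succ_bot (by omega : 0 < T + 1), zero_add, Finset.Ico_add_one_right_eq_Icc]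
  have h2 : f 0 ≤ H := F.game.value_sub_bestResponse_le_horizon _ _
  change ((T + 1 : ℕ) : ℝ)⁻¹ * ∑ k : Fin (T + 1), f k ≤ ε
  rw [h1, inv_mul_le_iff₀ (by positivity)]
  have := hB i
  push_cast
  simp only [f] at *
  nlinarith

theorem samples_le (F : Framework H S A ν) {Γ₁ Γ₂ : ℝ} (hcost : F.CostBound Γ₁ Γ₂)
    (hΓ : 0 ≤ max Γ₁ Γ₂) (ω : Seeds Ξ) (T : ℕ) :
    (F.samples ω T : ℝ) ≤ T + (F.updates ω T).card * (H * ((F.R + 1) * (max Γ₁ Γ₂ * T))) := by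
  have hlayer : ∀ t ∈ F.updates ω T, ∀ h ∈ Finset.range H,
      (F.layerCost ω t h : ℝ) ≤ (F.R + 1) * (max Γ₁ Γ₂ * T) := by
    intro t ht h hh
    obtain ⟨ht1, htT⟩ := Finset.mem_Icc.1 (Finset.mem_filter.1 ht).1
    have hh := Finset.mem_range.1 hh
    have htT : (t : ℝ) ≤ T := by exact_mod_cast htT
    have hmono : ∀ Γ ≤ max Γ₁ Γ₂, Γ * t ≤ max Γ₁ Γ₂ * T := fun Γ hle =>
      (mul_le_mul_of_nonneg_right hle (Nat.cast_nonneg t)).trans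
        (mul_le_mul_of_nonneg_left htT hΓ)
    rw [add_mul, one_mul, layerCost]
    push_cast
    refine add_le_add ?_ ((hcost.2 _ _ _ _ _ _ _ _ hh ht1 ht1).trans
      (hmono _ (le_max_right _ _)))
    refine (Finset.sum_le_sum fun r _ => (hcost.1 _ _ _ _ _ _ hh ht1 ht1).trans
      (hmono _ (le_max_left _ _))).trans_eq ?_
    simp
  rw [samples]
  push_cast
  refine add_le_add le_rfl ?_
  refine (Finset.sum_le_sum fun t ht => Finset.sum_le_sum (hlayer t ht)).trans_eq ?_
  simp

end Framework
end Framework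
end
end AVLPR

theorem mainTheorem2 :
    ∃ C₁ C₂ : ℝ, 0 < C₁ ∧ 0 < C₂ ∧
      ∀ (m H : ℕ) (S : ℕ → Type u) (A : Fin m → Type v) (Ξ : Type w)
        [∀ h, Fintype (S h)] [∀ i, Fintype (A i)] [∀ i, Nonempty (A i)]
        [MeasurableSpace Ξ] (ν : Measure Ξ) [IsProbabilityMeasure ν]
        (F : AVLPR.Framework H S A ν) (T : ℕ) (δ L d : ℝ),
        1 ≤ m → 1 ≤ H → 1 ≤ T → 0 < δ → δ < 1 → 0 ≤ L →
        F.R = AVLPR.Framework.numRuns H S δ →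
        F.GapRegular → F.PerStateNoRegret δ → F.OptimisticV δ →
        F.FewUpdates T d → F.PigeonHole T δ L →
        -- the summed CCE-regret
        AVLPR.seedLaw ν {ω | ¬ F.regret ω T ≤ C₂ * (m * H * √(L * T)) * Real.log (T / δ)}
            ≤ ENNReal.ofReal (C₂ * (H * (d * Real.log T) * F.R) * δ) ∧
        -- the output and the number of samples
        ∀ ε Γ₁ Γ₂ : ℝ, 0 < ε → ε ≤ H → 1 ≤ L → 1 ≤ max Γ₁ Γ₂ → F.CostBound Γ₁ Γ₂ →
          T = ⌈C₁ * (m ^ 2 * H ^ 2 * L / ε ^ 2)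
                * Real.log (2 * (m ^ 2 * H ^ 2 * L / ε ^ 2) / δ) ^ 2⌉₊ →
          AVLPR.seedLaw ν {ω | ¬ (F.game.IsCCE (F.output ω T) ε ∧
                F.game.IsInformedCCE (F.output ω T) ε)}
              ≤ ENNReal.ofReal (C₂ * (H * (d * Real.log T) * F.R) * δ) ∧
          ∀ᵐ ω ∂AVLPR.seedLaw ν, (F.samples ω T : ℝ) ≤
            C₂ * (max Γ₁ Γ₂ * (m ^ 2 * H ^ 3 * L / ε ^ 2) * (d * Real.log T))
              * (F.R * Real.log (2 * (m ^ 2 * H ^ 2 * L / ε ^ 2) / δ) ^ 2) := by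
  -- 393216 = 3 · 131072, where 131072 comes from `epochs_le` and 3 from the sample count at the
  -- end; it also dominates the 4 of the regret and probability bounds.
  refine ⟨65536, 393216, by norm_num, by norm_num, ?_⟩
  intro m H S A Ξ _ _ _ _ ν _ F T δ L d hm hH hT hδ hδ1 _ hR hreg hnr hopt hfew hpig
  have : Nonempty (S 0) := ⟨F.game.init⟩
  have hmain := F.seedLaw_not_regret_le hH hT hδ hδ1 hR hreg hnr hopt hfew hpig
  have hd := F.one_le_updates_bound hT hfew
  have hT1 : (1 : ℝ) ≤ T := by exact_mod_cast hT
  have hH1 : (1 : ℝ) ≤ H := by exact_mod_cast hH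
  have hR1 : (1 : ℝ) ≤ F.R := by
    rw [hR]; exact_mod_cast (AVLPR.Framework.numRuns_spec (S := S) hH hδ hδ1).1
  have hprob : ENNReal.ofReal (4 * (H * (d * Real.log T) * F.R) * δ)
      ≤ ENNReal.ofReal (393216 * (H * (d * Real.log T) * F.R) * δ) := by
    refine ENNReal.ofReal_le_ofReal ?_
    gcongr
    norm_num
  have hlog : 0 ≤ Real.log (T / δ) :=
    Real.log_nonneg (by rw [le_div_iff₀ hδ]; linarith)
  refine ⟨(measure_mono fun ω hω => ?_).trans (hmain.trans hprob), ?_⟩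
  · refine fun hgood => hω (hgood.1.trans ?_)
    gcongr
    norm_num
  intro ε Γ₁ Γ₂ hε hεH hL hΓ hcost hTeq
  obtain ⟨hX1, hbound⟩ := AVLPR.regret_bound_le hm hH hL hε hεH hδ hδ1 hT rfl hTeq
  refine ⟨(measure_mono fun ω hω => ?_).trans (hmain.trans hprob), ?_⟩
  · intro hgood
    have hcce := F.isInformedCCE_output hgood.2 hε.le hbound
    exact hω ⟨F.game.isCCE_of_isInformedCCE hcce, hcce⟩
  · have hTle := AVLPR.epochs_le hX1 hδ hδ1 hTeq
    filter_upwards [hfew] with ω hω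
    refine (F.samples_le hcost (by linarith) ω T).trans ?_
    have hX3 : (m : ℝ) ^ 2 * H ^ 3 * L / ε ^ 2 = H * (m ^ 2 * H ^ 2 * L / ε ^ 2) := by ring
    rw [hX3]
    generalize (m : ℝ) ^ 2 * H ^ 2 * L / ε ^ 2 = X at *
    generalize Real.log (2 * X / δ) = l at *
    generalize d * Real.log T = D at *
    generalize max Γ₁ Γ₂ = Γ at *
    -- This absorbs the `T` rollouts into the cost of the calls; with `R + 1 ≤ 2 * R` the total
    -- factor is 3.
    have hP : 1 ≤ D * (H * (F.R * Γ)) := one_le_mul_of_one_le_of_one_le hd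
      (one_le_mul_of_one_le_of_one_le hH1 (one_le_mul_of_one_le_of_one_le hR1 hΓ))
    have hΓ0 : 0 ≤ Γ := by linarith
    calc _ ≤ T + D * (H * ((F.R + F.R) * (Γ * T))) := by gcongr
      _ = T + 2 * (D * (H * (F.R * Γ)) * T) := by ring
      _ ≤ D * (H * (F.R * Γ)) * T + 2 * (D * (H * (F.R * Γ)) * T) := by
        gcongr
        exact le_mul_of_one_le_left (by positivity) hP
      _ = 3 * (D * (H * (F.R * Γ))) * T := by ring
      _ ≤ 3 * (D * (H * (F.R * Γ))) * (131072 * (X * l ^ 2)) := by gcongr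
      _ = _ := by ring
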